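/- **Setting.** Let $(\mathcal S,\mathcal A,\mathbb P,r,H)$ be an episodic Markov decision process with finite state space $\mathcal S$, action space $\mathcal A$, rewards $r:\mathcal S\times\mathcal A\to[0,1]$ and transition probabilities $\mathbb P(\tilde s\mid s,a)=\phi(s,a)^\top \mathbf M_\star\psi(\tilde s)$, where $\phi(s,a)\in\mathbb R^d$, $\psi(s)\in\mathbb R^{d'}$, $\mathbf M_\star\in\mathbb R^{d\times d'}$. Let $\Psi\in\mathbb R^{|\mathcal S|\times d'}$ be the matrix with rows $\psi(s)^\top$, and assume that $\mathbf K_\psi=\sum_{s}\psi(s)\psi(s)^\top$ is invertible, $\|\phi(s,a)\|_2\le L_\phi$, $\|\psi(s)\|_2\le L_\psi$ and $\|\mathbf M_\star[:,i]\|_2\le S$ for all $s,a,i$. For given constants $C_\psi, C'_\psi$ consider the following two conditions. * *Feature regularity*: $\|\Psi^\top \mathbf v\|_\infty\le C_\psi\|\mathbf v\|_\infty$ for all $\mathbf v\in\mathbb R^{|\mathcal S|}$, and every row of $\Psi\mathbf K_\psi^{-1}$ has $\ell_2$ norm at most $C'_\psi$. * *Stronger feature regularity*: $\|\Psi^\top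 \mathbf v\|_2\le C_\psi\|\mathbf v\|_\infty$ for all $\mathbf v\in\mathbb R^{|\mathcal S|}$, and every row of $\Psi\mathbf K_\psi^{-1}$ has $\ell_2$ norm at most $C'_\psi$. **Algorithm (MatrixRL).** Fix $\lambda>0$ and $\delta\in(0,1)$. Let $s_{n,h},a_{n,h}$ be the state and the action at stage $h$ of episode $n$, where the next state $s_{n,h+1}$ is drawn from $\mathbb P(\cdot\mid s_{n,h},a_{n,h})$ given the history, and the initial states $s_{n,1}$ are arbitrary (possibly random and dependent on the past). Write $\phi_{n,h}=\phi(s_{n,h},a_{n,h})$, $\psi_{n,h}=\psi(s_{n,h+1})$, and $$\Sigma_n=\lambda\mathbf I+\sum_{n'<n,\,h\le H}\phi_{n',h}\phi_{n',h}^\top,\qquad \widetilde{\mathbf M}_n=\Sigma_n^{-1}\sum_{n'<n,\,h\le H}\phi_{n',h}\psi_{n',h}^\top\mathbf K_\psi^{-1},$$ $$\sqrt{\beta_n}=R\sqrt{d\log\Big(\frac{d'+d'nHL_\phi^2/\lambda}{\delta}\Big)}+\sqrt\lambda\,S,\qquad R=\|\mathbf K_\psi^{-1}\|L_\psi+SL_\phi,$$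 with $\|\mathbf K_\psi^{-1}\|$ the operator norm. The confidence sets are $$\mathbf U_n^{1,2}=\Big\{\mathbf M:\sum_{i=1}^{d'}\big\|\Sigma_n^{1/2}(\mathbf M-\widetilde{\mathbf M}_n)[:,i]\big\|_2\le d'\sqrt{\beta_n}\Big\},\qquad \mathbf U_n^{F}=\Big\{\mathbf M:\big\|\Sigma_n^{1/2}(\mathbf M-\widetilde{\mathbf M}_n)\big\|_F\le\sqrt{d'\beta_n}\Big\}.$$ With $\mathbf U_n$ one of these two sets, put $V_{n,H+1}=0$ and, for $h=H,\dots,1$, $$Q_{n,h}(s,a)=r(s,a)+\max_{\mathbf M\in\mathbf U_n}\phi(s,a)^\top\mathbf M\Psi^\top V_{n,h+1},\qquad V_{n,h}(s)=\min\{H,\max\{0,\max_aQ_{n,h}(s,a)\}\}.$$ In episode $n$ the algorithm plays the policy $\pi_n$ given by $\pi_{n,h}(s)\in\arg\max_aQ_{n,h}(s,a)$, with ties broken in any way. For a policy $\pi$ let $V_1^\pi(s)$ be the expected total reward of an episode started at $s$, and let $V_1^{\pi_\star}(s)$ be its optimal value (the supremum over policies). **Theorem.** Let $N H\ge 2$.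 For $\gamma_N\ge0$ as specified below, with probability at least $1-2\delta$ the regret $R(NH)=\sum_{n=1}^N\big(V_1^{\pi_\star}(s_{n,1})-V_1^{\pi_n}(s_{n,1})\big)$ satisfies $$R(NH)\le 8H\sqrt{NH\log\Big(\frac{6\log (NH)}{\delta}\Big)}+2\sqrt{2\gamma_NNHd\log\Big(1+\frac{NHL_\phi^2}{\lambda d}\Big)}+2L_\phi Hd\sqrt{\frac{\gamma_N}{\lambda}}\,\log\Big(1+\frac{NL_\phi^2}{\lambda d}\Big)$$ in each of the following two cases: 1. feature regularity holds, the algorithm uses $\mathbf U_n=\mathbf U_n^{1,2}$, and $\sqrt{\gamma_N}=2C_\psi Hd'\sqrt{\beta_N}$; 2. stronger feature regularity holds, the algorithm uses $\mathbf U_n=\mathbf U_n^{F}$, and $\sqrt{\gamma_N}=2C_\psi H\sqrt{d'\beta_N}$. -/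

import Mathlib

open MeasureTheory Matrix

/-- The Euclidean (`l₂`) norm of a real vector. -/
noncomputable def l2norm {k : ℕ} (x : Fin k → ℝ) : ℝ := ‖WithLp.toLp 2 x‖

/-- An episodic Markov decision process `(St, Act, P, r, H)` with finite state space, rewards in
`[0,1]`, and transition probabilities `P(s' | s, a) = φ(s,a)ᵀ M⋆ ψ(s')`. -/
structure MatrixMDP (St Act : Type*) [Fintype St] (d d' : ℕ) where
  /-- state-action features -/
  φ : St → Act → Fin d → ℝ
  /-- next-state features -/
  ψ : St → Fin d' → ℝ
  /-- the core matrix `M⋆`, unknown to the learner -/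
  Mstar : Matrix (Fin d) (Fin d') ℝ
  /-- transition probabilities, `P s a s'` being the probability of moving to `s'` -/
  P : St → Act → St → ℝ
  /-- reward function -/
  r : St → Act → ℝ
  /-- horizon -/
  H : ℕ
  P_nonneg : ∀ s a s', 0 ≤ P s a s'
  P_sum : ∀ s a, ∑ s', P s a s' = 1
  P_eq : ∀ s a s', P s a s' = φ s a ⬝ᵥ (Mstar *ᵥ ψ s')
  r_mem : ∀ s a, r s a ∈ Set.Icc (0 : ℝ) 1

namespace MatrixMDP

variable {St Act : Type*} [Fintype St] {d d' : ℕ}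

/-- The matrix `Ψ` whose rows are the vectors `ψ(s)`. -/
def Psi (m : MatrixMDP St Act d d') : Matrix St (Fin d') ℝ := Matrix.of m.ψ

/-- `K_ψ = ∑ s, ψ(s) ψ(s)ᵀ`. -/
def K (m : MatrixMDP St Act d d') : Matrix (Fin d') (Fin d') ℝ :=
  ∑ s, vecMulVec (m.ψ s) (m.ψ s)

/-- Boundedness: `‖φ(s,a)‖₂ ≤ Lφ`, `‖ψ(s)‖₂ ≤ Lψ`, and `‖M⋆[:,i]‖₂ ≤ SM` for every column. -/
structure Bounded (m : MatrixMDP St Act d d') (Lφ Lψ SM : ℝ) : Prop where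
  phi_le : ∀ s a, l2norm (m.φ s a) ≤ Lφ
  psi_le : ∀ s, l2norm (m.ψ s) ≤ Lψ
  col_le : ∀ i, l2norm (fun j => m.Mstar j i) ≤ SM

/-- Feature regularity. The norm of `v : St → ℝ` and of `Ψᵀ v` is the sup norm. -/
structure FeatureRegularity (m : MatrixMDP St Act d d') (Cψ Cψ' : ℝ) : Prop where
  psi_le : ∀ v : St → ℝ, ‖m.Psiᵀ *ᵥ v‖ ≤ Cψ * ‖v‖
  psiK_le : ∀ s, l2norm ((m.Psi * m.K⁻¹) s) ≤ Cψ'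

/-- Stronger feature regularity: the `l₂` norm of `Ψᵀ v` against the sup norm of `v`. -/
structure StrongFeatureRegularity (m : MatrixMDP St Act d d') (Cψ Cψ' : ℝ) : Prop where
  psi_le : ∀ v : St → ℝ, l2norm (m.Psiᵀ *ᵥ v) ≤ Cψ * ‖v‖
  psiK_le : ∀ s, l2norm ((m.Psi * m.K⁻¹) s) ≤ Cψ'

/-! ### Value functions

A (deterministic, stage-dependent) policy is a map `π : ℕ → St → Act`; `π h s` is the action
played in state `s` at stage `h`, and only the stages `1, …, H` matter. -/

/-- Expected total reward of `π` over the last `k` stages, i.e. from stage `H + 1 - k` on. -/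
noncomputable def valueToGo (m : MatrixMDP St Act d d') (π : ℕ → St → Act) : ℕ → St → ℝ
  | 0 => fun _ => 0
  | k + 1 => fun s =>
      m.r s (π (m.H - k) s) + ∑ s', m.P s (π (m.H - k) s) s' * m.valueToGo π k s'

/-- The value `V_h^π(s)`. -/
noncomputable def value (m : MatrixMDP St Act d d') (π : ℕ → St → Act) (h : ℕ) (s : St) : ℝ :=
  m.valueToGo π (m.H + 1 - h) s

/-- The optimal value at the first stage, `V_1^{π⋆}(s)`. -/
noncomputable def optValue (m : MatrixMDP St Act d d') (s : St) : ℝ :=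
  ⨆ π : ℕ → St → Act, m.value π 1 s

/-! ### The quantities computed by the learner

Here `x n h` is the state at stage `h` of episode `n`, and `a n h` the action played there;
episodes and stages are numbered from `1`, and `x n (H + 1)` is the last state of episode `n`. -/

/-- `Σ_n = λ I + ∑_{n' < n, h ≤ H} φ_{n',h} φ_{n',h}ᵀ`. -/
noncomputable def Sig (m : MatrixMDP St Act d d') (lam : ℝ) (x : ℕ → ℕ → St) (a : ℕ → ℕ → Act)
    (n : ℕ) : Matrix (Fin d) (Fin d) ℝ :=
  lam • (1 : Matrix (Fin d) (Fin d) ℝ) +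
    ∑ n' ∈ Finset.Ico 1 n, ∑ h ∈ Finset.Icc 1 m.H,
      vecMulVec (m.φ (x n' h) (a n' h)) (m.φ (x n' h) (a n' h))

/-- The ridge estimator `Σ_n⁻¹ ∑_{n' < n, h ≤ H} φ_{n',h} ψ_{n',h}ᵀ K_ψ⁻¹`, where `ψ_{n',h}` is the
feature of the state that follows stage `h`. -/
noncomputable def Mhat (m : MatrixMDP St Act d d') (lam : ℝ) (x : ℕ → ℕ → St) (a : ℕ → ℕ → Act)
    (n : ℕ) : Matrix (Fin d) (Fin d') ℝ :=
  (m.Sig lam x a n)⁻¹ *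
    (∑ n' ∈ Finset.Ico 1 n, ∑ h ∈ Finset.Icc 1 m.H,
      vecMulVec (m.φ (x n' h) (a n' h)) (m.ψ (x n' (h + 1)))) * (m.K)⁻¹

/-- `R = ‖K_ψ⁻¹‖ Lψ + SM Lφ`, with the operator norm of `K_ψ⁻¹`. -/
noncomputable def noise (m : MatrixMDP St Act d d') (Lφ Lψ SM : ℝ) : ℝ :=
  ‖Matrix.toEuclideanCLM (n := Fin d') (𝕜 := ℝ) (m.K)⁻¹‖ * Lψ + SM * Lφ

/-- `√β_n = R √(d log((d' + d' n H Lφ² / λ) / δ)) + √λ SM`. -/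
noncomputable def rootBeta (m : MatrixMDP St Act d d') (Lφ Lψ SM lam δ : ℝ) (n : ℕ) : ℝ :=
  m.noise Lφ Lψ SM *
      √(d * Real.log ((d' + d' * n * m.H * Lφ ^ 2 / lam) / δ)) + √lam * SM

/-- `‖v‖_Σ = √(vᵀ Σ v)`, which is `‖Σ^{1/2} v‖₂` for positive semidefinite `Σ`. -/
noncomputable def weightedNorm (Sg : Matrix (Fin d) (Fin d) ℝ) (v : Fin d → ℝ) : ℝ :=
  √(v ⬝ᵥ (Sg *ᵥ v))

/-- `U_n^{1,2}`: the matrices `M` with `‖Σ_n^{1/2} (M - M̃_n)‖_{2,1} ≤ d' √β_n`, the norm being the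
sum of the `l₂` norms of the columns. -/
def confSet12 (m : MatrixMDP St Act d d') (Lφ Lψ SM lam δ : ℝ) (x : ℕ → ℕ → St)
    (a : ℕ → ℕ → Act) (n : ℕ) : Set (Matrix (Fin d) (Fin d') ℝ) :=
  {M | ∑ i, weightedNorm (m.Sig lam x a n) (fun j => (M - m.Mhat lam x a n) j i)
      ≤ d' * m.rootBeta Lφ Lψ SM lam δ n}

/-- `U_n^F`: the matrices `M` with `‖Σ_n^{1/2} (M - M̃_n)‖_F ≤ √(d' β_n)`. -/
def confSetF (m : MatrixMDP St Act d d') (Lφ Lψ SM lam δ : ℝ) (x : ℕ → ℕ → St)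
    (a : ℕ → ℕ → Act) (n : ℕ) : Set (Matrix (Fin d) (Fin d') ℝ) :=
  {M | √(∑ i, weightedNorm (m.Sig lam x a n) (fun j => (M - m.Mhat lam x a n) j i) ^ 2)
      ≤ √(d' * m.rootBeta Lφ Lψ SM lam δ n ^ 2)}

/-- `r(s,a) + max_{M ∈ U} φ(s,a)ᵀ M Ψᵀ V`. -/
noncomputable def backup (m : MatrixMDP St Act d d') (U : Set (Matrix (Fin d) (Fin d') ℝ))
    (V : St → ℝ) (s : St) (a : Act) : ℝ :=
  m.r s a + sSup ((fun M => m.φ s a ⬝ᵥ (M *ᵥ (m.Psiᵀ *ᵥ V))) '' U)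

/-- The optimistic value function with `k` stages left: `0` for `k = 0`, and then the projection
to `[0,H]` of the maximum over the actions of the optimistic `Q` function. -/
noncomputable def optimisticV (m : MatrixMDP St Act d d') (U : Set (Matrix (Fin d) (Fin d') ℝ)) :
    ℕ → St → ℝ
  | 0 => fun _ => 0
  | k + 1 => fun s => max 0 (min (m.H : ℝ) (⨆ a, m.backup U (m.optimisticV U k) s a))

/-- The optimistic `Q` function at stage `h ∈ {1, …, H}`. -/
noncomputable def optimisticQ (m : MatrixMDP St Act d d') (U : Set (Matrix (Fin d) (Fin d') ℝ))
    (h : ℕ) (s : St) (a : Act) : ℝ :=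
  m.backup U (m.optimisticV U (m.H - h)) s a

/-! ### The interaction of the algorithm with the process

`x n h ω` is the state at stage `h` of episode `n`, and `π n ω` the policy of episode `n`. -/

section Run

variable {Ω : Type*} [MeasurableSpace St] [MeasurableSpace Act]

/-- The information available when the action of stage `h` in episode `n` is played: the earlier
episodes, the states of the current episode up to stage `h`, and the policies so far. -/
abbrev history (H : ℕ) (x : ℕ → ℕ → Ω → St) (π : ℕ → Ω → ℕ → St → Act) (n h : ℕ) :
    MeasurableSpace Ω :=
  (⨆ l ∈ Set.Icc 1 n, ⨆ k ∈ Set.Icc 1 H,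
      MeasurableSpace.comap (fun ω => π l ω k) inferInstance) ⊔
  (⨆ l ∈ Set.Ico 1 n, ⨆ k ∈ Set.Icc 1 (H + 1), MeasurableSpace.comap (x l k) inferInstance) ⊔
  (⨆ k ∈ Set.Icc 1 h, MeasurableSpace.comap (x n k) inferInstance)

/-- The action played at stage `h` of episode `n`. -/
def action (x : ℕ → ℕ → Ω → St) (π : ℕ → Ω → ℕ → St → Act) (ω : Ω) (n h : ℕ) : Act :=
  π n ω h (x n h ω)

/-- `N` episodes of MatrixRL on the process `m`, with confidence sets `U x a n` computed from the
data of the episodes before `n`. The initial states `x n 1` and the breaking of ties are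
arbitrary, possibly random and dependent on the past. -/
structure IsMatrixRLRun [MeasurableSpace Ω] (m : MatrixMDP St Act d d') (μ : Measure Ω)
    (U : (ℕ → ℕ → St) → (ℕ → ℕ → Act) → ℕ → Set (Matrix (Fin d) (Fin d') ℝ)) (N : ℕ)
    (x : ℕ → ℕ → Ω → St) (π : ℕ → Ω → ℕ → St → Act) : Prop where
  measurable_state : ∀ n ∈ Set.Icc 1 N, ∀ h ∈ Set.Icc 1 (m.H + 1), Measurable (x n h)
  measurable_policy : ∀ n ∈ Set.Icc 1 N, ∀ h ∈ Set.Icc 1 m.H, Measurable (fun ω => π n ω h)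
  /-- the next state is drawn from `P(· | s, a)`, given the history -/
  transition : ∀ n ∈ Set.Icc 1 N, ∀ h ∈ Set.Icc 1 m.H, ∀ s' : St,
    μ[(x n (h + 1) ⁻¹' {s'}).indicator (fun _ => (1 : ℝ)) | history m.H x π n h]
      =ᵐ[μ] fun ω => m.P (x n h ω) (action x π ω n h) s'
  /-- the policy of episode `n` plays a maximizer of the optimistic `Q` function -/
  greedy : ∀ n ∈ Set.Icc 1 N, ∀ᵐ ω ∂μ, ∀ h ∈ Set.Icc 1 m.H, ∀ s b,
    m.optimisticQ (U (fun l k => x l k ω) (action x π ω) n) h s b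
      ≤ m.optimisticQ (U (fun l k => x l k ω) (action x π ω) n) h s (π n ω h s)

/-- The regret `∑_{n ≤ N} (V_1^{π⋆}(s_{n,1}) - V_1^{π_n}(s_{n,1}))`. -/
noncomputable def regret (m : MatrixMDP St Act d d') (N : ℕ) (x : ℕ → ℕ → Ω → St)
    (π : ℕ → Ω → ℕ → St → Act) (ω : Ω) : ℝ :=
  ∑ n ∈ Finset.Icc 1 N, (m.optValue (x n 1 ω) - m.value (π n ω) 1 (x n 1 ω))

end Run

/-- The regret bound with the parameter `γ_N = γ`. -/
noncomputable def regretBound (m : MatrixMDP St Act d d') (Lφ lam δ γ : ℝ) (N : ℕ) : ℝ :=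
  8 * m.H * √(N * m.H * Real.log (6 * Real.log (N * m.H) / δ))
    + 2 * √(2 * γ * N * m.H * d * Real.log (1 + N * m.H * Lφ ^ 2 / (lam * d)))
    + 2 * Lφ * m.H * d * √(γ / lam) * Real.log (1 + N * Lφ ^ 2 / (lam * d))

end MatrixMDP

/-!
The regret bound rests on optimism, a self-normalized concentration inequality and an elliptical
potential argument.

*Confidence.* For each column `i` the regression noise `(ψ(s')ᵀ K⁻¹)_i - φᵀ M⋆[:,i]` has conditional
mean zero and is bounded by `R`. With `S` the sum of the noise times `φ` and `Σ` the Gram matrix,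
`√(λ^d / det Σ) exp(‖S‖²_{Σ⁻¹} / 2R²)` is a supermartingale. For bounded noise this needs no
Gaussian mixture: the Sherman–Morrison formula makes the exponent after one step quadratic in the
noise, the square of the noise is at most `R²`, and Hoeffding's lemma handles the remaining linear
term (`sum_mul_selfNormalized_le`). Ville's inequality, with failure probability `δ / d'` for each
column, puts `M⋆` into all the confidence sets with probability at least `1 - δ`, provided that
`d ≥ 2`. In dimension one `√β_n` is too small for this argument, but there the transition
probabilities do not depend on the action at all, a greedy policy maximizes the reward, and the
regret is at most zero (`optValue_le_value_of_phi_const`).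

*Optimism.* When `M⋆` lies in the confidence set, the optimistic value function dominates the
optimal one, and exceeds the value of the played policy by at most the expected sum of the bonuses
`√γ ‖φ‖_{Σ⁻¹}` along an episode, truncated at `H`. That sum, `bonusValue`, involves no
supremum over confidence sets, so it is measurable with respect to the history, and along the
trajectory it is at most the sum of the truncated bonuses plus a martingale, which the
Azuma–Hoeffding inequality bounds with probability at least `1 - δ`.

*Summation.* Let `Y_n` be the sum of `‖φ‖²_{Σ_n⁻¹}` over episode `n`. Since
`det Σ_{n+1} ≥ det Σ_n (1 + Y_n)`, the sum of `min(1, Y_n)` is at most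
`2 d log(1 + N H Lφ² / (λ d))`. Episodes with `Y_n ≤ 1` are summed by the Cauchy–Schwarz inequality,
and each of the others costs at most `H²`. The latter cost is absorbed by the second term of the
bound, because `√γ` is at least `2H` times the square root of the total potential: the constant
`Cψ` and the norm of `K⁻¹` cannot both be small (`one_le_norm_K_inv_mul`). This works as soon as
`H ≤ 2 N`; if `N ≤ 64 H` the first term of the bound alone exceeds `N H`. Of the third term only
the sign is used.
-/

/-! ### Positive definite matrices -/

section LinearAlgebra

variable {d : ℕ}

lemma Matrix.PosDef.exists_transpose_mul {A : Matrix (Fin d) (Fin d) ℝ} (hA : A.PosDef) :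
    ∃ B : Matrix (Fin d) (Fin d) ℝ, A = Bᵀ * B := by
  open scoped MatrixOrder in
  obtain ⟨B, hB⟩ := CStarAlgebra.nonneg_iff_eq_star_mul_self.mp hA.posSemidef.nonneg
  exact ⟨B, by simpa [star_eq_conjTranspose] using hB⟩

lemma Matrix.PosDef.transpose_eq {A : Matrix (Fin d) (Fin d) ℝ} (hA : A.PosDef) : Aᵀ = A := by
  simpa [IsHermitian] using hA.isHermitian

lemma Matrix.PosDef.dotProduct_mulVec_comm {A : Matrix (Fin d) (Fin d) ℝ} (hA : A.PosDef)
    (u v : Fin d → ℝ) : u ⬝ᵥ (A *ᵥ v) = v ⬝ᵥ (A *ᵥ u) := by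
  rw [dotProduct_mulVec, ← mulVec_transpose, hA.transpose_eq, dotProduct_comm]

lemma Matrix.PosDef.quadratic_nonneg {A : Matrix (Fin d) (Fin d) ℝ} (hA : A.PosDef)
    (v : Fin d → ℝ) : 0 ≤ v ⬝ᵥ (A *ᵥ v) := by
  simpa using hA.posSemidef.dotProduct_mulVec_nonneg v

lemma Matrix.PosDef.isUnit_det {A : Matrix (Fin d) (Fin d) ℝ} (hA : A.PosDef) :
    IsUnit A.det := hA.det_pos.ne'.isUnit

lemma l2norm_sq (v : Fin d → ℝ) : l2norm v ^ 2 = v ⬝ᵥ v := by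
  rw [l2norm, EuclideanSpace.norm_sq_eq]
  simp [dotProduct, pow_two]

lemma l2norm_nonneg (v : Fin d → ℝ) : 0 ≤ l2norm v := norm_nonneg _

lemma dotProduct_le_l2norm_mul (u v : Fin d → ℝ) : u ⬝ᵥ v ≤ l2norm u * l2norm v := by
  have := real_inner_le_norm (WithLp.toLp 2 v) (WithLp.toLp 2 u)
  simpa [l2norm, EuclideanSpace.inner_eq_star_dotProduct, mul_comm] using this

lemma abs_apply_le_l2norm (v : Fin d → ℝ) (i : Fin d) : |v i| ≤ l2norm v := by
  simpa [l2norm] using PiLp.norm_apply_le (WithLp.toLp 2 v) i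

lemma abs_dotProduct_le_l2norm_mul (u v : Fin d → ℝ) : |u ⬝ᵥ v| ≤ l2norm u * l2norm v := by
  have h := abs_real_inner_le_norm (WithLp.toLp 2 v) (WithLp.toLp 2 u)
  simpa [l2norm, EuclideanSpace.inner_eq_star_dotProduct, mul_comm] using h

/-- The `l₂` norm is at most `√d` times the sup norm. -/
lemma l2norm_le_sqrt_mul_norm (v : Fin d → ℝ) : l2norm v ≤ √d * ‖v‖ := by
  refine abs_le_of_sq_le_sq' ?_ (by positivity) |>.2
  rw [l2norm_sq, mul_pow, Real.sq_sqrt (by positivity)]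
  have : v ⬝ᵥ v ≤ ∑ _i : Fin d, ‖v‖ ^ 2 := by
    refine Finset.sum_le_sum fun i _ => ?_
    have := norm_le_pi_norm v i
    rw [← pow_two, ← sq_abs]
    exact pow_le_pow_left₀ (abs_nonneg _) this 2
  simpa using this

namespace MatrixMDP

lemma weightedNorm_nonneg (A : Matrix (Fin d) (Fin d) ℝ) (v : Fin d → ℝ) :
    0 ≤ weightedNorm A v := Real.sqrt_nonneg _

lemma weightedNorm_sq {A : Matrix (Fin d) (Fin d) ℝ} (hA : A.PosDef) (v : Fin d → ℝ) :
    weightedNorm A v ^ 2 = v ⬝ᵥ (A *ᵥ v) := Real.sq_sqrt (hA.quadratic_nonneg v)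

lemma weightedNorm_eq_l2norm (B : Matrix (Fin d) (Fin d) ℝ) (v : Fin d → ℝ) :
    weightedNorm (Bᵀ * B) v = l2norm (B *ᵥ v) := by
  rw [weightedNorm, ← mulVec_mulVec, dotProduct_mulVec, vecMul_transpose, ← l2norm_sq,
    Real.sqrt_sq (l2norm_nonneg _)]

lemma weightedNorm_sub_le {A : Matrix (Fin d) (Fin d) ℝ} (hA : A.PosDef) (u v : Fin d → ℝ) :
    weightedNorm A (u - v) ≤ weightedNorm A u + weightedNorm A v := by
  obtain ⟨B, rfl⟩ := hA.exists_transpose_mul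
  simp only [weightedNorm_eq_l2norm, mulVec_sub]
  simpa [l2norm] using norm_sub_le (WithLp.toLp 2 (B *ᵥ u)) (WithLp.toLp 2 (B *ᵥ v))

lemma weightedNorm_smul (A : Matrix (Fin d) (Fin d) ℝ) {c : ℝ} (hc : 0 ≤ c)
    (v : Fin d → ℝ) : weightedNorm A (c • v) = c * weightedNorm A v := by
  rw [weightedNorm, weightedNorm, mulVec_smul, dotProduct_smul, smul_dotProduct, smul_smul,
    smul_eq_mul, Real.sqrt_mul (mul_self_nonneg c), Real.sqrt_mul_self hc]

lemma weightedNorm_inv_mulVec {A : Matrix (Fin d) (Fin d) ℝ} (hA : A.PosDef) (v : Fin d → ℝ) :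
    weightedNorm A (A⁻¹ *ᵥ v) = weightedNorm A⁻¹ v := by
  rw [weightedNorm, weightedNorm, mulVec_mulVec, mul_nonsing_inv _ hA.isUnit_det, one_mulVec,
    dotProduct_comm]

/-- The Cauchy–Schwarz inequality for the dual norms `‖·‖_{A⁻¹}` and `‖·‖_A`. -/
lemma abs_dotProduct_le_weightedNorm {A : Matrix (Fin d) (Fin d) ℝ} (hA : A.PosDef)
    (u v : Fin d → ℝ) : |u ⬝ᵥ v| ≤ weightedNorm A⁻¹ u * weightedNorm A v := by
  rw [← weightedNorm_inv_mulVec hA]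
  have h : u ⬝ᵥ v = (A⁻¹ *ᵥ u) ⬝ᵥ (A *ᵥ v) := by
    rw [hA.dotProduct_mulVec_comm, mulVec_mulVec, mul_nonsing_inv _ hA.isUnit_det, one_mulVec,
      dotProduct_comm]
  rw [h]
  obtain ⟨B, rfl⟩ := hA.exists_transpose_mul
  rw [weightedNorm_eq_l2norm, weightedNorm_eq_l2norm, ← mulVec_mulVec, dotProduct_mulVec,
    vecMul_transpose]
  exact abs_dotProduct_le_l2norm_mul _ _

/-- If `A ≥ c` then `‖v‖_{A⁻¹} ≤ ‖v‖ / √c`. -/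
lemma weightedNorm_inv_le {A : Matrix (Fin d) (Fin d) ℝ} (hA : A.PosDef) {c : ℝ} (hc : 0 < c)
    (hcA : ∀ v, c * (v ⬝ᵥ v) ≤ v ⬝ᵥ (A *ᵥ v)) (v : Fin d → ℝ) :
    √c * weightedNorm A⁻¹ v ≤ l2norm v := by
  set w := A⁻¹ *ᵥ v with hw
  have hAw : A *ᵥ w = v := by
    rw [hw, mulVec_mulVec, mul_nonsing_inv _ hA.isUnit_det, one_mulVec]
  have h1 := hcA w
  have h2 : weightedNorm A⁻¹ v ^ 2 = w ⬝ᵥ v := by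
    rw [weightedNorm_sq hA.inv, dotProduct_comm]
  rw [hAw] at h1
  have h3 := dotProduct_le_l2norm_mul w v
  rw [← l2norm_sq] at h1
  have h4 := l2norm_nonneg w
  have h5 := l2norm_nonneg v
  refine abs_le_of_sq_le_sq' ?_ h5 |>.2
  rw [mul_pow, Real.sq_sqrt hc.le, h2]
  rcases h4.eq_or_lt with h0 | h0
  · rw [← h0] at h3
    nlinarith
  · have h6 : c * l2norm w ≤ l2norm v := by nlinarith
    nlinarith

end MatrixMDP

lemma dotProduct_vecMulVec_mulVec (u v : Fin d → ℝ) :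
    v ⬝ᵥ (vecMulVec u u *ᵥ v) = (u ⬝ᵥ v) ^ 2 := by
  rw [vecMulVec_mulVec, dotProduct_smul, dotProduct_comm v u]
  simp [pow_two]

lemma posSemidef_vecMulVec_self (u : Fin d → ℝ) : (vecMulVec u u).PosSemidef := by
  simpa using posSemidef_vecMulVec_self_star u

/-- The **Sherman–Morrison formula** for a symmetric rank-one update. -/
lemma Matrix.PosDef.inv_add_vecMulVec {A : Matrix (Fin d) (Fin d) ℝ} (hA : A.PosDef)
    (u : Fin d → ℝ) :
    (A + vecMulVec u u)⁻¹ =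
      A⁻¹ - (1 + u ⬝ᵥ (A⁻¹ *ᵥ u))⁻¹ • vecMulVec (A⁻¹ *ᵥ u) (A⁻¹ *ᵥ u) := by
  have hq := hA.inv.quadratic_nonneg u
  apply inv_eq_right_inv
  have h1 : A * vecMulVec (A⁻¹ *ᵥ u) (A⁻¹ *ᵥ u) = vecMulVec u (A⁻¹ *ᵥ u) := by
    rw [mul_vecMulVec, mulVec_mulVec, mul_nonsing_inv _ hA.isUnit_det, one_mulVec]
  have h2 : vecMulVec u u * A⁻¹ = vecMulVec u (A⁻¹ *ᵥ u) := by
    rw [vecMulVec_mul, ← mulVec_transpose, hA.inv.transpose_eq]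
  have h3 : vecMulVec u u * vecMulVec (A⁻¹ *ᵥ u) (A⁻¹ *ᵥ u)
      = (u ⬝ᵥ (A⁻¹ *ᵥ u)) • vecMulVec u (A⁻¹ *ᵥ u) := by
    ext i j
    simp [vecMulVec_mul_vecMulVec, vecMulVec_apply, mul_left_comm]
  rw [Matrix.mul_sub, Matrix.add_mul, mul_nonsing_inv _ hA.isUnit_det, h2, Matrix.mul_smul,
    Matrix.add_mul, h1, h3]
  set q := u ⬝ᵥ (A⁻¹ *ᵥ u)
  set X := vecMulVec u (A⁻¹ *ᵥ u)
  have h4 : X + q • X = (1 + q) • X := by rw [add_smul, one_smul]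
  rw [h4, smul_smul, inv_mul_cancel₀ (by positivity), one_smul, add_sub_cancel_right]

lemma Matrix.PosDef.det_add_vecMulVec {A : Matrix (Fin d) (Fin d) ℝ} (hA : A.PosDef)
    (u : Fin d → ℝ) :
    (A + vecMulVec u u).det = A.det * (1 + u ⬝ᵥ (A⁻¹ *ᵥ u)) := by
  have h := det_add_replicateCol_mul_replicateRow (ι := Unit) hA.isUnit_det u u
  rw [← vecMulVec_eq] at h
  rw [h]
  congr 1
  rw [det_unique]
  simp [Matrix.mul_apply, dotProduct, mulVec, Finset.mul_sum, Finset.sum_mul,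
    replicateRow, replicateCol]
  rw [Finset.sum_comm]
  simp [mul_assoc]

lemma one_add_sum_le_prod_one_add {ι : Type*} (s : Finset ι) (f : ι → ℝ)
    (hf : ∀ i ∈ s, 0 ≤ f i) : 1 + ∑ i ∈ s, f i ≤ ∏ i ∈ s, (1 + f i) := by
  classical
  induction s using Finset.induction_on with
  | empty => simp
  | insert a s ha ih =>
    rw [Finset.sum_insert ha, Finset.prod_insert ha]
    have h1 := ih fun i hi => hf i (Finset.mem_insert_of_mem hi)
    have h2 := hf a (Finset.mem_insert_self _ _)
    have h3 : 0 ≤ ∑ i ∈ s, f i := Finset.sum_nonneg fun i hi => hf i (Finset.mem_insert_of_mem hi)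
    nlinarith

lemma Matrix.PosSemidef.one_add_trace_le_det {P : Matrix (Fin d) (Fin d) ℝ}
    (hP : P.PosSemidef) : 1 + P.trace ≤ (1 + P).det := by
  have hA : (1 + P).IsHermitian := (PosSemidef.one.add hP).isHermitian
  have h1 : ∀ i, 0 ≤ hA.eigenvalues i - 1 := fun i => by
    have h := hA.eigenvalues_eq i
    set v : Fin d → ℝ := (hA.eigenvectorBasis i).ofLp with hv
    have hn : v ⬝ᵥ v = 1 := by
      have := (hA.eigenvectorBasis.orthonormal.1 i)
      rw [← l2norm_sq]
      simp [l2norm, hv, this]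
    have h2 := hP.dotProduct_mulVec_nonneg v
    simp only [star_trivial, add_mulVec, one_mulVec, dotProduct_add, hn] at h h2
    simp only [RCLike.re_to_real] at h
    linarith
  have hdet := hA.det_eq_prod_eigenvalues
  have htr := hA.trace_eq_sum_eigenvalues
  simp only [RCLike.ofReal_real_eq_id, id] at hdet htr
  have := one_add_sum_le_prod_one_add Finset.univ _ fun i _ => h1 i
  simp only [add_sub_cancel, Finset.sum_sub_distrib, ← htr, ← hdet, trace_add, trace_one] at this
  simpa using this

/-- `det (A + ∑ u uᵀ) ≥ det A (1 + ∑ ‖u‖²_{A⁻¹})`, where all the norms are taken with respect to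
the same matrix `A`. -/
lemma Matrix.PosDef.det_mul_le_det_add_sum {A : Matrix (Fin d) (Fin d) ℝ} (hA : A.PosDef)
    {ι : Type*} (s : Finset ι) (u : ι → Fin d → ℝ) :
    A.det * (1 + ∑ i ∈ s, u i ⬝ᵥ (A⁻¹ *ᵥ u i)) ≤ (A + ∑ i ∈ s, vecMulVec (u i) (u i)).det := by
  obtain ⟨C, hC⟩ := hA.inv.exists_transpose_mul
  set W := ∑ i ∈ s, vecMulVec (u i) (u i) with hW
  have hWp : W.PosSemidef := posSemidef_sum s fun i _ => posSemidef_vecMulVec_self (u i)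
  have hP : (C * W * Cᵀ).PosSemidef := by
    simpa using hWp.mul_mul_conjTranspose_same C
  have h1 : A + W = A * (1 + A⁻¹ * W) := by
    rw [Matrix.mul_add, Matrix.mul_one, ← Matrix.mul_assoc, mul_nonsing_inv _ hA.isUnit_det,
      Matrix.one_mul]
  have h2 : (1 + A⁻¹ * W).det = (1 + C * W * Cᵀ).det := by
    rw [hC, Matrix.mul_assoc, det_one_add_mul_comm]
  have h3 : (C * W * Cᵀ).trace = ∑ i ∈ s, u i ⬝ᵥ (A⁻¹ *ᵥ u i) := by
    rw [trace_mul_comm, ← Matrix.mul_assoc, ← hC, hW, Finset.mul_sum, trace_sum]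
    refine Finset.sum_congr rfl fun i _ => ?_
    rw [mul_vecMulVec, trace_vecMulVec, dotProduct_comm]
  rw [h1, det_mul, h2, ← h3]
  exact mul_le_mul_of_nonneg_left hP.one_add_trace_le_det hA.det_pos.le

/-- The determinant is at most the `d`-th power of the mean of the eigenvalues. -/
lemma Matrix.PosDef.det_le_pow_trace_div {A : Matrix (Fin d) (Fin d) ℝ} (hA : A.PosDef)
    (hd : 0 < d) : A.det ≤ (A.trace / d) ^ d := by
  have hne : Nonempty (Fin d) := ⟨⟨0, hd⟩⟩
  have hdet := hA.isHermitian.det_eq_prod_eigenvalues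
  have htr := hA.isHermitian.trace_eq_sum_eigenvalues
  simp only [RCLike.ofReal_real_eq_id, id] at hdet htr
  have hm : 0 < A.trace / d := div_pos hA.trace_pos (by exact_mod_cast hd)
  set m := A.trace / d with hmdef
  have h1 : ∏ i, (hA.isHermitian.eigenvalues i / m) ≤
      ∏ i, Real.exp (hA.isHermitian.eigenvalues i / m - 1) := by
    refine Finset.prod_le_prod (fun i _ => div_nonneg (hA.eigenvalues_pos i).le hm.le)
      fun i _ => ?_
    have := Real.add_one_le_exp (hA.isHermitian.eigenvalues i / m - 1)
    linarith
  have h2 : ∑ i, (hA.isHermitian.eigenvalues i / m - 1) = 0 := by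
    rw [Finset.sum_sub_distrib, ← Finset.sum_div, ← htr]
    have : (d : ℝ) ≠ 0 := by exact_mod_cast hd.ne'
    have htr0 : A.trace ≠ 0 := hA.trace_pos.ne'
    simp [hmdef]
    field_simp
    simp
  rw [← Real.exp_sum, h2, Real.exp_zero, Finset.prod_div_distrib, ← hdet] at h1
  simp only [Finset.prod_const, Finset.card_univ, Fintype.card_fin] at h1
  rwa [div_le_one (by positivity)] at h1

end LinearAlgebra

/-! ### Exponential supermartingales driven by finite-state transitions -/

section Probability

open scoped ENNReal

variable {Ω St : Type*} [MeasurableSpace St]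

/-- If `p` is the conditional probability of `E` given `F`, then integrating an `F`-measurable
function over `E` is the same as integrating it against the density `p`. -/
lemma setLIntegral_eq_lintegral_condProb_mul {F m0 : MeasurableSpace Ω} (hF : F ≤ m0)
    {μ : Measure Ω} [IsProbabilityMeasure μ] {E : Set Ω} (hE : MeasurableSet E) {p : Ω → ℝ}
    (hp : μ[E.indicator (fun _ => (1 : ℝ)) | F] =ᵐ[μ] p) {g : Ω → ℝ≥0∞}
    (hg : Measurable[F] g) :
    ∫⁻ ω in E, g ω ∂μ = ∫⁻ ω, ENNReal.ofReal (p ω) * g ω ∂μ := by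
  set q := μ[E.indicator (fun _ => (1 : ℝ)) | F] with hq
  have hqm : Measurable[F] (fun ω => ENNReal.ofReal (q ω)) :=
    (stronglyMeasurable_condExp.measurable).ennreal_ofReal
  have hint : Integrable (E.indicator (fun _ => (1 : ℝ))) μ :=
    (integrable_const (1 : ℝ)).indicator hE
  have hq0 : 0 ≤ᵐ[μ] q :=
    condExp_nonneg (Filter.Eventually.of_forall fun ω => Set.indicator_nonneg (by simp) ω)
  have hν : (μ.restrict E).trim hF = (μ.trim hF).withDensity (fun ω => ENNReal.ofReal (q ω)) := by
    refine @Measure.ext Ω F _ _ fun B hB => ?_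
    rw [trim_measurableSet_eq hF hB, withDensity_apply _ hB, restrict_trim hF _ hB,
      lintegral_trim hF hqm, Measure.restrict_apply (hF _ hB),
      ← ofReal_integral_eq_lintegral_ofReal integrable_condExp.integrableOn
        (ae_restrict_of_ae hq0), setIntegral_condExp hF hint hB,
      setIntegral_indicator hE]
    simp [measureReal_def]
  have h1 : ∫⁻ ω, ENNReal.ofReal (p ω) * g ω ∂μ = ∫⁻ ω, ENNReal.ofReal (q ω) * g ω ∂μ := by
    refine lintegral_congr_ae ?_
    filter_upwards [hp] with ω h
    rw [h]
  rw [h1, ← lintegral_trim hF hg, hν, lintegral_withDensity_eq_lintegral_mul _ hqm hg]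
  exact lintegral_trim hF (hqm.mul hg)

lemma measurable_apply_of_finite [Finite St] [MeasurableSingletonClass St] [MeasurableSpace Ω]
    {β : Type*} [MeasurableSpace β] {f : Ω → St → β} {y : Ω → St}
    (hf : ∀ s, Measurable fun ω => f ω s) (hy : Measurable y) :
    Measurable fun ω => f ω (y ω) := by
  intro B hB
  have : (fun ω => f ω (y ω)) ⁻¹' B = ⋃ s, y ⁻¹' {s} ∩ (fun ω => f ω s) ⁻¹' B := by
    ext ω
    simp
  rw [this]
  exact MeasurableSet.iUnion fun s => (hy (measurableSet_singleton s)).inter (hf s hB)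

/-- A random sequence `y 0, …, y (T - 1)` in a finite set, with an increasing family of
`σ`-algebras such that `y t` is drawn from the distribution `p t` given `F t`, and is known
at time `t + 1`. -/
structure IsTransitionProcess [Fintype St] [m0 : MeasurableSpace Ω] (μ : Measure Ω)
    (F : ℕ → MeasurableSpace Ω) (T : ℕ) (y : ℕ → Ω → St) (p : ℕ → Ω → St → ℝ) : Prop where
  le : ∀ t < T, F t ≤ m0
  mono : ∀ t, t + 1 < T → F t ≤ F (t + 1)
  measurable : ∀ t < T, Measurable (y t)
  adapted : ∀ t, t + 1 < T → Measurable[F (t + 1)] (y t)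
  nonneg : ∀ t < T, ∀ ω s, 0 ≤ p t ω s
  sum_eq_one : ∀ t < T, ∀ ω, ∑ s, p t ω s = 1
  transition : ∀ t < T, ∀ s,
    μ[(y t ⁻¹' {s}).indicator (fun _ => (1 : ℝ)) | F t] =ᵐ[μ] fun ω => p t ω s

namespace IsTransitionProcess

variable [Fintype St] [m0 : MeasurableSpace Ω] {μ : Measure Ω}
  {F : ℕ → MeasurableSpace Ω} {T : ℕ} {y : ℕ → Ω → St} {p : ℕ → Ω → St → ℝ}

lemma F_mono (hP : IsTransitionProcess μ F T y p) {s t : ℕ} (hst : s ≤ t) (ht : t < T) :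
    F s ≤ F t := by
  induction t, hst using Nat.le_induction with
  | base => exact le_rfl
  | succ t _ ih => exact (ih (by omega)).trans (hP.mono t ht)

variable [MeasurableSingletonClass St]

lemma measurable_past (hP : IsTransitionProcess μ F T y p) {β : Type*} [MeasurableSpace β]
    {e : Ω → St → β} {j t : ℕ} (he : ∀ s, Measurable[F j] fun ω => e ω s) (hjt : j < t)
    (ht : t < T) : Measurable[F t] fun ω => e ω (y j ω) :=
  @measurable_apply_of_finite Ω St _ _ _ (F t) _ _ _ _
    (fun s => (he s).mono (hP.F_mono hjt.le ht) le_rfl)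
    ((hP.adapted j (by omega)).mono (hP.F_mono hjt ht) le_rfl)

lemma measurable_value (hP : IsTransitionProcess μ F T y p) {β : Type*} [MeasurableSpace β]
    {e : Ω → St → β} {j : ℕ} (he : ∀ s, Measurable[F j] fun ω => e ω s) (hj : j < T) :
    Measurable fun ω => e ω (y j ω) :=
  measurable_apply_of_finite (fun s => (he s).mono (hP.le j hj) le_rfl) (hP.measurable j hj)

/-- If the conditional mean of `G ω (y t ω)` is at most `Z`, then so it is on average over every
event known at time `t`. -/
lemma setLIntegral_le [IsProbabilityMeasure μ] (hP : IsTransitionProcess μ F T y p) {t : ℕ}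
    (ht : t < T) {G : Ω → St → ℝ≥0∞} (hG : ∀ s, Measurable[F t] fun ω => G ω s) {Z : Ω → ℝ≥0∞}
    (hZ : ∀ ω, ∑ s, ENNReal.ofReal (p t ω s) * G ω s ≤ Z ω) {A : Set Ω}
    (hA : MeasurableSet[F t] A) :
    ∫⁻ ω in A, G ω (y t ω) ∂μ ≤ ∫⁻ ω in A, Z ω ∂μ := by
  have hA0 := hP.le t ht _ hA
  have hE : ∀ s, MeasurableSet (y t ⁻¹' {s}) := fun s =>
    hP.measurable t ht (measurableSet_singleton s)
  have hGA : ∀ s, Measurable[F t] (A.indicator fun ω => G ω s) := fun s =>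
    Measurable.indicator (hG s) hA
  have hGA0 : ∀ s, Measurable (A.indicator fun ω => G ω s) := fun s =>
    (hGA s).mono (hP.le t ht) le_rfl
  have h1 : ∀ ω, A.indicator (fun ω => G ω (y t ω)) ω
      = ∑ s, (y t ⁻¹' {s}).indicator (A.indicator fun ω => G ω s) ω := fun ω => by
    rw [Finset.sum_eq_single (y t ω)]
    · by_cases h : ω ∈ A <;> simp [h]
    · intro s _ hs
      simp [hs.symm]
    · simp
  rw [← lintegral_indicator hA0, ← lintegral_indicator hA0]
  simp only [h1]
  rw [lintegral_finsetSum _ fun s _ => (hGA0 s).indicator (hE s)]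
  have h2 : ∀ s, ∫⁻ ω, (y t ⁻¹' {s}).indicator (A.indicator fun ω => G ω s) ω ∂μ
      = ∫⁻ ω, ENNReal.ofReal (p t ω s) * A.indicator (fun ω => G ω s) ω ∂μ := fun s => by
    rw [lintegral_indicator (hE s)]
    exact setLIntegral_eq_lintegral_condProb_mul (hP.le t ht) (hE s) (hP.transition t ht s)
      (hGA s)
  simp only [h2]
  have hpm : ∀ s, AEMeasurable (fun ω => ENNReal.ofReal (p t ω s)) μ := fun s =>
    (((stronglyMeasurable_condExp.mono (hP.le t ht)).aestronglyMeasurable.congr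
      (hP.transition t ht s)).aemeasurable).ennreal_ofReal
  have hm : ∀ s ∈ Finset.univ, AEMeasurable
      (fun ω => ENNReal.ofReal (p t ω s) * A.indicator (fun ω => G ω s) ω) μ := fun s _ =>
    (hpm s).mul (hGA0 s).aemeasurable
  rw [← lintegral_finsetSum' _ hm]
  refine lintegral_mono fun ω => ?_
  by_cases h : ω ∈ A
  · simpa [h] using hZ ω
  · simp [h]

end IsTransitionProcess

/-- **Ville's inequality** in finite time: a nonnegative supermartingale that starts at `Z 0`
ever reaches the level `c` with probability at most `E[Z 0] / c`. -/
lemma mul_measure_exists_le_lintegral [m0 : MeasurableSpace Ω] {μ : Measure Ω}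
    {F : ℕ → MeasurableSpace Ω} {T : ℕ} (hF : ∀ t ≤ T, F t ≤ m0)
    (hmono : ∀ t < T, F t ≤ F (t + 1)) {Z : ℕ → Ω → ℝ≥0∞}
    (hZ : ∀ t ≤ T, Measurable[F t] (Z t))
    (hsup : ∀ t < T, ∀ A, MeasurableSet[F t] A →
      ∫⁻ ω in A, Z (t + 1) ω ∂μ ≤ ∫⁻ ω in A, Z t ω ∂μ) (c : ℝ≥0∞) :
    c * μ {ω | ∃ t ≤ T, c ≤ Z t ω} ≤ ∫⁻ ω, Z 0 ω ∂μ := by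
  -- `A t` is the event that the level has not been reached up to time `t`
  set A : ℕ → Set Ω := fun t => {ω | ∀ s ≤ t, Z s ω < c} with hAdef
  have hlt : ∀ t ≤ T, MeasurableSet[F t] {ω | Z t ω < c} := fun t ht =>
    hZ t ht measurableSet_Iio
  have hAsucc : ∀ t, A (t + 1) = A t ∩ {ω | Z (t + 1) ω < c} := fun t => by
    ext ω
    simp only [hAdef, Set.mem_ofPred_eq, Set.mem_inter_iff]
    constructor
    · exact fun h => ⟨fun s hs => h s (by omega), h _ le_rfl⟩
    · rintro ⟨h1, h2⟩ s hs
      rcases Nat.le_succ_iff.mp hs with h | h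
      · exact h1 s h
      · exact h ▸ h2
  have hA : ∀ t ≤ T, MeasurableSet[F t] (A t) := by
    intro t
    induction t with
    | zero =>
      intro h
      have : A 0 = {ω | Z 0 ω < c} := by
        ext ω
        simp [hAdef]
      rw [this]
      exact hlt 0 h
    | succ t ih =>
      intro h
      rw [hAsucc]
      exact MeasurableSet.inter (hmono t (by omega) _ (ih (by omega))) (hlt _ h)
  have key : ∀ t ≤ T, c * μ (A t)ᶜ + ∫⁻ ω in A t, Z t ω ∂μ ≤ ∫⁻ ω, Z 0 ω ∂μ := by
    intro t
    induction t with
    | zero =>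
      intro h
      have hm := hF 0 h _ (hA 0 h)
      rw [← lintegral_add_compl (μ := μ) (Z 0) hm, add_comm]
      refine add_le_add le_rfl ?_
      rw [← setLIntegral_const]
      refine setLIntegral_mono' hm.compl fun ω hω => ?_
      simpa [hAdef] using hω
    | succ t ih =>
      intro h
      have h1 := ih (by omega)
      have h2 := hsup t (by omega) _ (hA t (by omega))
      have hm := hF t (by omega) _ (hA t (by omega))
      have hm' : MeasurableSet {ω | Z (t + 1) ω < c} := hF _ h _ (hlt _ h)
      have h3 : c * μ (A t \ {ω | Z (t + 1) ω < c}) + ∫⁻ ω in A (t + 1), Z (t + 1) ω ∂μ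
          ≤ ∫⁻ ω in A t, Z (t + 1) ω ∂μ := by
        rw [← lintegral_inter_add_sdiff _ (A t) hm', hAsucc, add_comm]
        refine add_le_add le_rfl ?_
        rw [← setLIntegral_const]
        refine setLIntegral_mono' (hm.diff hm') fun ω hω => ?_
        simpa using hω.2
      have h4 : μ (A (t + 1))ᶜ ≤ μ (A t)ᶜ + μ (A t \ {ω | Z (t + 1) ω < c}) := by
        refine (measure_mono ?_).trans (measure_union_le _ _)
        rw [hAsucc]
        intro ω hω
        by_cases hωA : ω ∈ A t
        · exact Or.inr ⟨hωA, fun h => hω ⟨hωA, h⟩⟩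
        · exact Or.inl hωA
      calc c * μ (A (t + 1))ᶜ + ∫⁻ ω in A (t + 1), Z (t + 1) ω ∂μ
          ≤ c * μ (A t)ᶜ + (c * μ (A t \ {ω | Z (t + 1) ω < c})
              + ∫⁻ ω in A (t + 1), Z (t + 1) ω ∂μ) := by
            rw [← add_assoc, ← mul_add]
            gcongr
        _ ≤ c * μ (A t)ᶜ + ∫⁻ ω in A t, Z t ω ∂μ := by
            gcongr
            exact h3.trans h2
        _ ≤ _ := h1
  have hset : {ω | ∃ t ≤ T, c ≤ Z t ω} = (A T)ᶜ := by
    ext ω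
    simp [hAdef]
  rw [hset]
  exact le_self_add.trans (key T le_rfl)

/-- **Hoeffding's lemma** for a distribution on a finite set and a symmetric range. -/
lemma sum_mul_exp_le_of_mean_zero {ι : Type*} [Fintype ι] {p e : ι → ℝ} {R : ℝ} (hR : 0 < R)
    (hp : ∀ s, 0 ≤ p s) (hp1 : ∑ s, p s = 1) (he : ∀ s, |e s| ≤ R) (hmean : ∑ s, p s * e s = 0)
    (θ : ℝ) : ∑ s, p s * Real.exp (θ * e s) ≤ Real.exp (θ ^ 2 * R ^ 2 / 2) := by
  -- convexity bounds the exponential by its chord over `[-R, R]`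
  have h1 : ∀ s, Real.exp (θ * e s) ≤ Real.cosh (θ * R) + e s * (Real.sinh (θ * R) / R) := by
    intro s
    obtain ⟨h2, h3⟩ := abs_le.mp (he s)
    have h5 : 0 ≤ (R + e s) / (2 * R) := div_nonneg (by linarith) (by linarith)
    have h6 : 0 ≤ (R - e s) / (2 * R) := div_nonneg (by linarith) (by linarith)
    have h := convexOn_exp.2 (Set.mem_univ (θ * R)) (Set.mem_univ (-(θ * R))) h5 h6
      (by field_simp; ring)
    simp only [smul_eq_mul] at h
    have h4 : (R + e s) / (2 * R) * (θ * R) + (R - e s) / (2 * R) * -(θ * R) = θ * e s := by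
      field_simp
      ring
    rw [h4] at h
    refine h.trans (le_of_eq ?_)
    rw [Real.cosh_eq, Real.sinh_eq]
    field_simp
    ring
  calc ∑ s, p s * Real.exp (θ * e s)
      ≤ ∑ s, p s * (Real.cosh (θ * R) + e s * (Real.sinh (θ * R) / R)) :=
        Finset.sum_le_sum fun s _ => mul_le_mul_of_nonneg_left (h1 s) (hp s)
    _ = Real.cosh (θ * R) := by
        simp only [mul_add, Finset.sum_add_distrib, ← Finset.sum_mul, ← mul_assoc, hp1, hmean]
        ring
    _ ≤ Real.exp (θ ^ 2 * R ^ 2 / 2) := by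
        rw [← mul_pow]
        exact Real.cosh_le_exp_half_sq _

namespace IsTransitionProcess

variable [Fintype St] [MeasurableSingletonClass St] [m0 : MeasurableSpace Ω] {μ : Measure Ω}
  {F : ℕ → MeasurableSpace Ω} {T : ℕ} {y : ℕ → Ω → St} {p : ℕ → Ω → St → ℝ}

/-- The **Azuma–Hoeffding inequality**. -/
lemma measure_sum_gt_le [IsProbabilityMeasure μ] (hP : IsTransitionProcess μ F T y p)
    {e : ℕ → Ω → St → ℝ} {R δ : ℝ} (hR : 0 < R) (hT : 0 < T) (hδ0 : 0 < δ) (hδ1 : δ < 1)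
    (hem : ∀ t < T, ∀ s, Measurable[F t] fun ω => e t ω s)
    (he : ∀ t < T, ∀ ω s, |e t ω s| ≤ R)
    (hmean : ∀ t < T, ∀ ω, ∑ s, p t ω s * e t ω s = 0) :
    μ {ω | R * √(2 * T * Real.log (1 / δ)) < ∑ t ∈ Finset.range T, e t ω (y t ω)}
      ≤ ENNReal.ofReal δ := by
  have hlog : 0 < Real.log (1 / δ) := Real.log_pos (by rw [lt_div_iff₀ hδ0]; linarith)
  have hT' : (0 : ℝ) < T := by exact_mod_cast hT
  set ε := R * √(2 * T * Real.log (1 / δ)) with hε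
  have hε2 : ε ^ 2 = R ^ 2 * (2 * T * Real.log (1 / δ)) := by
    rw [hε, mul_pow, Real.sq_sqrt (by positivity)]
  have hε0 : 0 < ε := by positivity
  set θ := ε / (T * R ^ 2) with hθ
  have hθ0 : 0 < θ := by positivity
  set W : ℕ → Ω → ℝ := fun t ω => ∑ j ∈ Finset.range t, e j ω (y j ω) with hW
  set Z : ℕ → Ω → ℝ≥0∞ := fun t ω =>
    ENNReal.ofReal (Real.exp (θ * W t ω - t * (θ ^ 2 * R ^ 2 / 2))) with hZ
  have hWm : ∀ t < T, Measurable[F t] (W t) := fun t ht =>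
    Finset.measurable_fun_sum _ fun j hj =>
      hP.measurable_past (hem j (by have := Finset.mem_range.mp hj; omega))
        (Finset.mem_range.mp hj) ht
  have hstep : ∀ t < T, ∫⁻ ω, Z (t + 1) ω ∂μ ≤ ∫⁻ ω, Z t ω ∂μ := by
    intro t ht
    have := hP.setLIntegral_le ht (Z := Z t) (A := Set.univ)
      (G := fun ω s => ENNReal.ofReal
        (Real.exp (θ * (W t ω + e t ω s) - (t + 1 : ℕ) * (θ ^ 2 * R ^ 2 / 2))))
      (fun s => ?_) (fun ω => ?_) MeasurableSet.univ
    · simpa [hZ, hW, Finset.sum_range_succ] using this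
    · exact (Real.measurable_exp.comp
        ((((hWm t ht).add (hem t ht s)).const_mul θ).sub_const _)).ennreal_ofReal
    · simp only [← ENNReal.ofReal_mul (hP.nonneg t ht ω _)]
      rw [← ENNReal.ofReal_sum_of_nonneg fun s _ =>
        mul_nonneg (hP.nonneg t ht ω s) (Real.exp_pos _).le]
      apply ENNReal.ofReal_le_ofReal
      have h1 := sum_mul_exp_le_of_mean_zero hR (hP.nonneg t ht ω) (hP.sum_eq_one t ht ω)
        (he t ht ω) (hmean t ht ω) θ
      calc ∑ s, p t ω s * Real.exp (θ * (W t ω + e t ω s) - (t + 1 : ℕ) * (θ ^ 2 * R ^ 2 / 2))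
          = Real.exp (θ * W t ω - (t + 1 : ℕ) * (θ ^ 2 * R ^ 2 / 2))
              * ∑ s, p t ω s * Real.exp (θ * e t ω s) := by
            rw [Finset.mul_sum]
            refine Finset.sum_congr rfl fun s _ => ?_
            rw [mul_left_comm, ← Real.exp_add]
            congr 2
            ring
        _ ≤ Real.exp (θ * W t ω - (t + 1 : ℕ) * (θ ^ 2 * R ^ 2 / 2))
              * Real.exp (θ ^ 2 * R ^ 2 / 2) :=
            mul_le_mul_of_nonneg_left h1 (Real.exp_pos _).le
        _ = Real.exp (θ * W t ω - t * (θ ^ 2 * R ^ 2 / 2)) := by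
            rw [← Real.exp_add]
            congr 1
            push_cast
            ring
  have hall : ∀ t ≤ T, ∫⁻ ω, Z t ω ∂μ ≤ 1 := by
    intro t
    induction t with
    | zero => simp [hZ, hW]
    | succ t ih => exact fun h => (hstep t (by omega)).trans (ih (by omega))
  have hZm : Measurable (Z T) := by
    refine (Real.measurable_exp.comp (Measurable.sub_const (Measurable.const_mul ?_ θ)
      _)).ennreal_ofReal
    exact Finset.measurable_fun_sum _ fun j hj =>
      hP.measurable_value (hem j (Finset.mem_range.mp hj)) (Finset.mem_range.mp hj)
  have hmarkov := mul_meas_ge_le_lintegral (μ := μ) hZm (ENNReal.ofReal (1 / δ))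
  have hsub : {ω | ε < ∑ t ∈ Finset.range T, e t ω (y t ω)}
      ⊆ {ω | ENNReal.ofReal (1 / δ) ≤ Z T ω} := by
    intro ω hω
    simp only [Set.mem_ofPred_eq] at hω ⊢
    apply ENNReal.ofReal_le_ofReal
    rw [← Real.log_le_iff_le_exp (by positivity)]
    have h2 : θ * ε ≤ θ * W T ω := mul_le_mul_of_nonneg_left hω.le hθ0.le
    have h3 : θ * ε - T * (θ ^ 2 * R ^ 2 / 2) = Real.log (1 / δ) := by
      rw [hθ]
      field_simp
      rw [hε2]
      field_simp
      ring
    linarith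
  have h5 : ENNReal.ofReal (1 / δ) * μ {ω | ε < ∑ t ∈ Finset.range T, e t ω (y t ω)} ≤ 1 :=
    (mul_le_mul_right (measure_mono hsub) _).trans (hmarkov.trans (hall T le_rfl))
  rw [one_div, ENNReal.ofReal_inv_of_pos hδ0] at h5
  rwa [ENNReal.inv_mul_le_iff (by simpa using hδ0) (by simp), mul_one] at h5

end IsTransitionProcess

/-- One step of the self-normalized supermartingale: with `A' = A + u uᵀ` and a centred noise
`e` with values in `[-R, R]`,
`E[√(c / det A') exp(‖S + e u‖²_{A'⁻¹} / 2R²)] ≤ √(c / det A) exp(‖S‖²_{A⁻¹} / 2R²)`. -/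
lemma sum_mul_selfNormalized_le {d : ℕ} {ι : Type*} [Fintype ι] {p e : ι → ℝ} {R c : ℝ}
    (hR : 0 < R) (hc : 0 ≤ c)
    (hp : ∀ s, 0 ≤ p s) (hp1 : ∑ s, p s = 1) (he : ∀ s, |e s| ≤ R) (hmean : ∑ s, p s * e s = 0)
    {A : Matrix (Fin d) (Fin d) ℝ} (hA : A.PosDef) (S u : Fin d → ℝ) :
    ∑ s, p s * (√(c / (A + vecMulVec u u).det) *
      Real.exp ((S + e s • u) ⬝ᵥ ((A + vecMulVec u u)⁻¹ *ᵥ (S + e s • u)) / (2 * R ^ 2)))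
    ≤ √(c / A.det) * Real.exp (S ⬝ᵥ (A⁻¹ *ᵥ S) / (2 * R ^ 2)) := by
  set q := u ⬝ᵥ (A⁻¹ *ᵥ u) with hq
  set a := S ⬝ᵥ (A⁻¹ *ᵥ u) with ha
  set V := S ⬝ᵥ (A⁻¹ *ᵥ S) with hV
  have hq0 : 0 ≤ q := hA.inv.quadratic_nonneg u
  have ha' : u ⬝ᵥ (A⁻¹ *ᵥ S) = a := hA.inv.dotProduct_mulVec_comm _ _
  have hquad : ∀ s, (S + e s • u) ⬝ᵥ ((A + vecMulVec u u)⁻¹ *ᵥ (S + e s • u))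
      = V + (2 * e s * a + e s ^ 2 * q - a ^ 2) / (1 + q) := by
    intro s
    rw [hA.inv_add_vecMulVec, sub_mulVec, smul_mulVec, dotProduct_sub, dotProduct_smul,
      dotProduct_vecMulVec_mulVec, ← hq, smul_eq_mul]
    have h1 : (A⁻¹ *ᵥ u) ⬝ᵥ (S + e s • u) = a + e s * q := by
      rw [dotProduct_add, dotProduct_smul, dotProduct_comm, ← ha, dotProduct_comm, ← hq,
        smul_eq_mul]
    rw [h1]
    simp only [mulVec_add, mulVec_smul, dotProduct_add, add_dotProduct, smul_dotProduct,
      dotProduct_smul, smul_eq_mul, ← hq, ← ha, ← hV, ha']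
    field_simp
    ring
  -- since `e² ≤ R²`, the exponent is bounded by an affine function of the noise
  set θ := a / (R ^ 2 * (1 + q)) with hθ
  have hexp : ∀ s, Real.exp ((S + e s • u) ⬝ᵥ ((A + vecMulVec u u)⁻¹ *ᵥ (S + e s • u))
      / (2 * R ^ 2))
      ≤ Real.exp (V / (2 * R ^ 2) + (R ^ 2 * q - a ^ 2) / (2 * R ^ 2 * (1 + q)))
        * Real.exp (θ * e s) := by
    intro s
    rw [← Real.exp_add, hquad]
    apply Real.exp_le_exp.mpr
    have h1 : e s ^ 2 ≤ R ^ 2 := sq_le_sq' (abs_le.mp (he s)).1 (abs_le.mp (he s)).2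
    have h2 : V / (2 * R ^ 2) + (R ^ 2 * q - a ^ 2) / (2 * R ^ 2 * (1 + q)) + θ * e s
        - (V + (2 * e s * a + e s ^ 2 * q - a ^ 2) / (1 + q)) / (2 * R ^ 2)
        = (R ^ 2 - e s ^ 2) * q / (2 * R ^ 2 * (1 + q)) := by
      rw [hθ]
      field_simp
      ring
    have h3 : 0 ≤ (R ^ 2 - e s ^ 2) * q / (2 * R ^ 2 * (1 + q)) :=
      div_nonneg (mul_nonneg (by linarith) hq0) (by positivity)
    linarith
  have hmain : ∑ s, p s * Real.exp ((S + e s • u) ⬝ᵥ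
      ((A + vecMulVec u u)⁻¹ *ᵥ (S + e s • u)) / (2 * R ^ 2))
      ≤ Real.exp (V / (2 * R ^ 2)) * √(1 + q) := by
    calc _ ≤ ∑ s, p s * (Real.exp (V / (2 * R ^ 2) + (R ^ 2 * q - a ^ 2) / (2 * R ^ 2 * (1 + q)))
        * Real.exp (θ * e s)) :=
          Finset.sum_le_sum fun s _ => mul_le_mul_of_nonneg_left (hexp s) (hp s)
      _ = Real.exp (V / (2 * R ^ 2) + (R ^ 2 * q - a ^ 2) / (2 * R ^ 2 * (1 + q)))
        * ∑ s, p s * Real.exp (θ * e s) := by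
          rw [Finset.mul_sum]
          exact Finset.sum_congr rfl fun s _ => by ring
      _ ≤ Real.exp (V / (2 * R ^ 2) + (R ^ 2 * q - a ^ 2) / (2 * R ^ 2 * (1 + q)))
        * Real.exp (θ ^ 2 * R ^ 2 / 2) :=
          mul_le_mul_of_nonneg_left (sum_mul_exp_le_of_mean_zero hR hp hp1 he hmean θ)
            (Real.exp_pos _).le
      _ ≤ Real.exp (V / (2 * R ^ 2)) * Real.exp (Real.log (1 + q) * (1 / 2)) := by
          rw [← Real.exp_add, ← Real.exp_add]
          apply Real.exp_le_exp.mpr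
          have h1 : 1 - (1 + q)⁻¹ ≤ Real.log (1 + q) :=
            Real.one_sub_inv_le_log_of_pos (by positivity)
          have h2 : (R ^ 2 * q - a ^ 2) / (2 * R ^ 2 * (1 + q)) + θ ^ 2 * R ^ 2 / 2
              = (1 - (1 + q)⁻¹) * (1 / 2) - a ^ 2 * q / (2 * R ^ 2 * (1 + q) ^ 2) := by
            rw [hθ]
            field_simp
            ring
          have h3 : 0 ≤ a ^ 2 * q / (2 * R ^ 2 * (1 + q) ^ 2) := by positivity
          linarith
      _ = Real.exp (V / (2 * R ^ 2)) * √(1 + q) := by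
          rw [Real.sqrt_eq_rpow, Real.rpow_def_of_pos (by positivity)]
  have hdet : √(c / (A + vecMulVec u u).det) * √(1 + q) = √(c / A.det) := by
    have := hA.det_pos
    rw [hA.det_add_vecMulVec, ← hq, ← Real.sqrt_mul (by positivity)]
    congr 1
    field_simp
  calc _ = √(c / (A + vecMulVec u u).det) * ∑ s, p s * Real.exp ((S + e s • u) ⬝ᵥ
      ((A + vecMulVec u u)⁻¹ *ᵥ (S + e s • u)) / (2 * R ^ 2)) := by
        rw [Finset.mul_sum]
        exact Finset.sum_congr rfl fun s _ => by ring
    _ ≤ √(c / (A + vecMulVec u u).det) * (Real.exp (V / (2 * R ^ 2)) * √(1 + q)) :=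
        mul_le_mul_of_nonneg_left hmain (Real.sqrt_nonneg _)
    _ = √(c / A.det) * Real.exp (V / (2 * R ^ 2)) := by
        rw [← hdet]
        ring

lemma measurable_matrix_det {Ω : Type*} [MeasurableSpace Ω] {d : ℕ}
    {A : Ω → Matrix (Fin d) (Fin d) ℝ} (hA : ∀ i j, Measurable fun ω => A ω i j) :
    Measurable fun ω => (A ω).det := by
  simp only [det_apply]
  exact Finset.measurable_fun_sum _ fun σ _ =>
    (Finset.measurable_fun_prod _ fun i _ => hA _ _).const_smul _

lemma measurable_matrix_inv {Ω : Type*} [MeasurableSpace Ω] {d : ℕ}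
    {A : Ω → Matrix (Fin d) (Fin d) ℝ} (hA : ∀ i j, Measurable fun ω => A ω i j) (i j : Fin d) :
    Measurable fun ω => (A ω)⁻¹ i j := by
  simp only [inv_def, Matrix.smul_apply, adjugate_apply, Ring.inverse_eq_inv', smul_eq_mul]
  refine (measurable_matrix_det hA).inv.mul (measurable_matrix_det fun k l => ?_)
  by_cases h : k = j
  · subst h
    simp
  · simpa [updateRow_ne h] using hA k l

lemma measurable_quadratic {Ω : Type*} [MeasurableSpace Ω] {d : ℕ}
    {A : Ω → Matrix (Fin d) (Fin d) ℝ} (hA : ∀ i j, Measurable fun ω => A ω i j)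
    {v : Ω → Fin d → ℝ} (hv : ∀ i, Measurable fun ω => v ω i) :
    Measurable fun ω => v ω ⬝ᵥ (A ω *ᵥ v ω) := by
  simp only [dotProduct, mulVec]
  exact Finset.measurable_fun_sum _ fun i _ => (hv i).mul
    (Finset.measurable_fun_sum _ fun j _ => (hA i j).mul (hv j))

namespace IsTransitionProcess

variable [Fintype St] [MeasurableSingletonClass St] [m0 : MeasurableSpace Ω] {μ : Measure Ω}
  {F : ℕ → MeasurableSpace Ω} {T : ℕ} {y : ℕ → Ω → St} {p : ℕ → Ω → St → ℝ}

/-- The **self-normalized tail bound** for vector-valued martingales `S_t = ∑ e_j u_j`, with a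
noise `e_j` in `[-R, R]` and the Gram matrices `A_t = lam I + ∑ u_j u_jᵀ`, uniformly in time. -/
lemma measure_exists_selfNormalized_le [IsProbabilityMeasure μ]
    (hP : IsTransitionProcess μ F T y p) {d : ℕ} {u : ℕ → Ω → Fin d → ℝ}
    {e : ℕ → Ω → St → ℝ} {R lam δ : ℝ} (hR : 0 < R) (hlam : 0 < lam) (hδ0 : 0 < δ)
    (hum : ∀ t < T, ∀ i, Measurable[F t] fun ω => u t ω i)
    (hem : ∀ t < T, ∀ s, Measurable[F t] fun ω => e t ω s)
    (he : ∀ t < T, ∀ ω s, |e t ω s| ≤ R)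
    (hmean : ∀ t < T, ∀ ω, ∑ s, p t ω s * e t ω s = 0)
    {A : ℕ → Ω → Matrix (Fin d) (Fin d) ℝ} {S : ℕ → Ω → Fin d → ℝ}
    (hA : ∀ t ω, A t ω = lam • (1 : Matrix (Fin d) (Fin d) ℝ)
      + ∑ j ∈ Finset.range t, vecMulVec (u j ω) (u j ω))
    (hS : ∀ t ω, S t ω = ∑ j ∈ Finset.range t, e j ω (y j ω) • u j ω) :
    μ {ω | ∃ t < T, 1 / δ ≤ √(lam ^ d / (A t ω).det) *
      Real.exp (S t ω ⬝ᵥ ((A t ω)⁻¹ *ᵥ S t ω) / (2 * R ^ 2))} ≤ ENNReal.ofReal δ := by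
  rcases Nat.eq_zero_or_pos T with hT | hT
  · simp [hT]
  have hApos : ∀ t ω, (A t ω).PosDef := fun t ω => by
    rw [hA]
    exact (PosDef.one.smul hlam).add_posSemidef
      (posSemidef_sum _ fun j _ => posSemidef_vecMulVec_self _)
  have hAm : ∀ t < T, ∀ i j, Measurable[F t] fun ω => A t ω i j := fun t ht i j => by
    simp only [hA, Matrix.add_apply, Matrix.sum_apply, vecMulVec_apply]
    refine Measurable.const_add (Finset.measurable_fun_sum _ fun k hk => ?_) _
    have hk' := Finset.mem_range.mp hk
    have h := fun i => (hum k (by omega) i).mono (hP.F_mono hk'.le ht) le_rfl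
    exact (h i).mul (h j)
  have hSm : ∀ t < T, ∀ i, Measurable[F t] fun ω => S t ω i := fun t ht i => by
    simp only [hS, Finset.sum_apply, Pi.smul_apply, smul_eq_mul]
    refine Finset.measurable_fun_sum _ fun k hk => ?_
    have hk' := Finset.mem_range.mp hk
    exact (hP.measurable_past (hem k (by omega)) hk' ht).mul
      ((hum k (by omega) i).mono (hP.F_mono hk'.le ht) le_rfl)
  set Z : ℕ → Ω → ℝ≥0∞ := fun t ω => ENNReal.ofReal (√(lam ^ d / (A t ω).det) *
      Real.exp (S t ω ⬝ᵥ ((A t ω)⁻¹ *ᵥ S t ω) / (2 * R ^ 2))) with hZ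
  have hval : ∀ {F' : MeasurableSpace Ω} {B : Ω → Matrix (Fin d) (Fin d) ℝ} {v : Ω → Fin d → ℝ},
      (∀ i j, Measurable[F'] fun ω => B ω i j) → (∀ i, Measurable[F'] fun ω => v ω i) →
      Measurable[F'] fun ω => ENNReal.ofReal (√(lam ^ d / (B ω).det) *
        Real.exp (v ω ⬝ᵥ ((B ω)⁻¹ *ᵥ v ω) / (2 * R ^ 2))) := fun hB hv =>
    (((measurable_matrix_det hB).const_div _).sqrt.mul (Real.measurable_exp.comp
      ((measurable_quadratic (measurable_matrix_inv hB) hv).div_const _))).ennreal_ofReal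
  have hAsucc : ∀ t ω, A (t + 1) ω = A t ω + vecMulVec (u t ω) (u t ω) := fun t ω => by
    rw [hA, hA, Finset.sum_range_succ, add_assoc]
  have hSsucc : ∀ t ω, S (t + 1) ω = S t ω + e t ω (y t ω) • u t ω := fun t ω => by
    rw [hS, hS, Finset.sum_range_succ]
  have hville := mul_measure_exists_le_lintegral (μ := μ) (F := F) (T := T - 1) (Z := Z)
    (fun t ht => hP.le t (by omega)) (fun t ht => hP.mono t (by omega))
    (fun t ht => hval (hAm t (by omega)) (hSm t (by omega)))
    (fun t ht B hB => by
      have ht' : t < T := by omega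
      have := hP.setLIntegral_le ht' (Z := Z t) (A := B)
        (G := fun ω s => ENNReal.ofReal (√(lam ^ d / (A (t + 1) ω).det) *
          Real.exp ((S t ω + e t ω s • u t ω) ⬝ᵥ
            ((A (t + 1) ω)⁻¹ *ᵥ (S t ω + e t ω s • u t ω)) / (2 * R ^ 2))))
        (fun s => ?_) (fun ω => ?_) hB
      · simpa only [hZ, hSsucc] using this
      · refine hval (fun i j => ?_) (fun i => ?_)
        · simp only [hAsucc, Matrix.add_apply, vecMulVec_apply]
          exact (hAm t ht' i j).add ((hum t ht' i).mul (hum t ht' j))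
        · exact (hSm t ht' i).add ((hem t ht' s).mul (hum t ht' i))
      · simp only [← ENNReal.ofReal_mul (hP.nonneg t ht' ω _)]
        rw [← ENNReal.ofReal_sum_of_nonneg fun s _ => mul_nonneg (hP.nonneg t ht' ω s)
          (mul_nonneg (Real.sqrt_nonneg _) (Real.exp_pos _).le)]
        apply ENNReal.ofReal_le_ofReal
        simp only [hAsucc]
        exact sum_mul_selfNormalized_le hR (by positivity) (hP.nonneg t ht' ω)
          (hP.sum_eq_one t ht' ω) (he t ht' ω) (hmean t ht' ω) (hApos t ω) _ _)
    (ENNReal.ofReal (1 / δ))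
  have hZ0 : ∫⁻ ω, Z 0 ω ∂μ = 1 := by
    have : ∀ ω, Z 0 ω = 1 := fun ω => by
      have : lam ^ d ≠ 0 := (pow_pos hlam d).ne'
      simp [hZ, hA, hS, this]
    simp [this]
  rw [hZ0] at hville
  have hset : {ω | ∃ t < T, 1 / δ ≤ √(lam ^ d / (A t ω).det) *
      Real.exp (S t ω ⬝ᵥ ((A t ω)⁻¹ *ᵥ S t ω) / (2 * R ^ 2))}
      ⊆ {ω | ∃ t ≤ T - 1, ENNReal.ofReal (1 / δ) ≤ Z t ω} := by
    rintro ω ⟨t, ht, h⟩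
    exact ⟨t, by omega, ENNReal.ofReal_le_ofReal h⟩
  have h5 := (mul_le_mul_right (measure_mono (μ := μ) hset) (ENNReal.ofReal (1 / δ))).trans hville
  have h6 : ENNReal.ofReal (1 / δ) = (ENNReal.ofReal δ)⁻¹ := by
    rw [one_div, ENNReal.ofReal_inv_of_pos hδ0]
  rwa [h6, ENNReal.inv_mul_le_iff (by simpa using hδ0) (by simp), mul_one] at h5

end IsTransitionProcess

end Probability

/-! ### Features, transitions, and the ridge estimator -/

namespace MatrixMDP

variable {St Act : Type*} [Fintype St] {d d' : ℕ}

lemma sum_P_mul_eq (m : MatrixMDP St Act d d') (s : St) (a : Act) (V : St → ℝ) :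
    ∑ s', m.P s a s' * V s' = m.φ s a ⬝ᵥ (m.Mstar *ᵥ (m.Psiᵀ *ᵥ V)) := by
  have h : m.Psiᵀ *ᵥ V = ∑ s', V s' • m.ψ s' := by
    ext i
    simp [mulVec, dotProduct, Psi, mul_comm]
  rw [h, mulVec_sum, dotProduct_sum]
  refine Finset.sum_congr rfl fun s' _ => ?_
  rw [mulVec_smul, dotProduct_smul, m.P_eq, smul_eq_mul, mul_comm]

lemma K_transpose (m : MatrixMDP St Act d d') : m.Kᵀ = m.K := by
  simp [K, transpose_sum, transpose_vecMulVec]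

lemma K_mulVec (m : MatrixMDP St Act d d') (v : Fin d' → ℝ) :
    m.K *ᵥ v = m.Psiᵀ *ᵥ (fun s => m.ψ s ⬝ᵥ v) := by
  ext i
  rw [K, sum_mulVec, Finset.sum_apply]
  simp only [vecMulVec_mulVec]
  simp [Psi, mulVec, dotProduct]

/-- The centred regression noise of coordinate `i` when the next state is `s'`. -/
noncomputable def noiseAt (m : MatrixMDP St Act d d') (i : Fin d') (s : St) (a : Act) (s' : St) :
    ℝ :=
  (m.ψ s' ᵥ* (m.K)⁻¹) i - m.φ s a ⬝ᵥ (fun j => m.Mstar j i)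

lemma sum_P_mul_noiseAt (m : MatrixMDP St Act d d') (hK : IsUnit m.K.det) (i : Fin d') (s : St)
    (a : Act) : ∑ s', m.P s a s' * m.noiseAt i s a s' = 0 := by
  simp only [noiseAt, mul_sub, Finset.sum_sub_distrib, ← Finset.sum_mul, m.P_sum, one_mul]
  rw [m.sum_P_mul_eq]
  have h : m.Psiᵀ *ᵥ (fun s' => (m.ψ s' ᵥ* (m.K)⁻¹) i) = Pi.single i 1 := by
    have h1 : (fun s' => (m.ψ s' ᵥ* (m.K)⁻¹) i)
        = fun s' => m.ψ s' ⬝ᵥ ((m.K)⁻¹ *ᵥ Pi.single i 1) := by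
      ext s'
      rw [mulVec_single_one]
      rfl
    rw [h1, ← m.K_mulVec, mulVec_mulVec, mul_nonsing_inv _ hK, one_mulVec]
  rw [h, mulVec_single_one]
  simp only [sub_eq_zero]
  rfl

lemma l2norm_K_inv_mulVec_le (m : MatrixMDP St Act d d') (v : Fin d' → ℝ) :
    l2norm ((m.K)⁻¹ *ᵥ v)
      ≤ ‖Matrix.toEuclideanCLM (n := Fin d') (𝕜 := ℝ) (m.K)⁻¹‖ * l2norm v := by
  have := (Matrix.toEuclideanCLM (n := Fin d') (𝕜 := ℝ) (m.K)⁻¹).le_opNorm (WithLp.toLp 2 v)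
  simpa [l2norm] using this

lemma abs_noiseAt_le (m : MatrixMDP St Act d d') {Lφ Lψ SM : ℝ} (hb : m.Bounded Lφ Lψ SM)
    (i : Fin d') (s : St) (a : Act) (s' : St) :
    |m.noiseAt i s a s'| ≤ m.noise Lφ Lψ SM := by
  have h1 : |(m.ψ s' ᵥ* (m.K)⁻¹) i|
      ≤ ‖Matrix.toEuclideanCLM (n := Fin d') (𝕜 := ℝ) (m.K)⁻¹‖ * Lψ := by
    rw [← mulVec_transpose, transpose_nonsing_inv, K_transpose]
    refine (abs_apply_le_l2norm _ i).trans ((m.l2norm_K_inv_mulVec_le _).trans ?_)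
    exact mul_le_mul_of_nonneg_left (hb.psi_le s') (norm_nonneg _)
  have h2 : |m.φ s a ⬝ᵥ (fun j => m.Mstar j i)| ≤ SM * Lφ := by
    refine (abs_dotProduct_le_l2norm_mul _ _).trans ?_
    rw [mul_comm]
    exact mul_le_mul (hb.col_le i) (hb.phi_le s a) (l2norm_nonneg _)
      ((l2norm_nonneg _).trans (hb.col_le i))
  exact (abs_sub _ _).trans (add_le_add h1 h2)

/-- The two factors in the product of the feature regularity constant with the noise level
compensate each other: `K_ψ⁻¹` is large when the map `Ψᵀ` is small. -/
lemma one_le_norm_K_inv_mul (m : MatrixMDP St Act d d') (hK : IsUnit m.K.det) {Lψ C : ℝ}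
    (hLψ : ∀ s, l2norm (m.ψ s) ≤ Lψ) (hLψ0 : 0 ≤ Lψ) (hC0 : 0 ≤ C)
    (hC : ∀ v : St → ℝ, l2norm (m.Psiᵀ *ᵥ v) ≤ C * ‖v‖) (i : Fin d') :
    1 ≤ ‖Matrix.toEuclideanCLM (n := Fin d') (𝕜 := ℝ) (m.K)⁻¹‖ * (C * Lψ) := by
  have h1 : (m.K)⁻¹ *ᵥ (m.K *ᵥ Pi.single i 1) = Pi.single i 1 := by
    rw [mulVec_mulVec, nonsing_inv_mul _ hK, one_mulVec]
  have h2 : l2norm (Pi.single i (1 : ℝ) : Fin d' → ℝ) = 1 := by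
    simp [l2norm]
  rw [← h2, ← h1]
  refine (m.l2norm_K_inv_mulVec_le _).trans (mul_le_mul_of_nonneg_left ?_ (norm_nonneg _))
  rw [K_mulVec]
  refine (hC _).trans (mul_le_mul_of_nonneg_left ?_ hC0)
  refine (pi_norm_le_iff_of_nonneg hLψ0).mpr fun s => ?_
  simpa using (abs_apply_le_l2norm (m.ψ s) i).trans (hLψ s)

section Trajectory

variable (m : MatrixMDP St Act d d') {lam : ℝ} (x : ℕ → ℕ → St) (a : ℕ → ℕ → Act)

lemma Sig_posDef (hlam : 0 < lam) (n : ℕ) : (m.Sig lam x a n).PosDef :=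
  (PosDef.one.smul hlam).add_posSemidef (posSemidef_sum _ fun _ _ =>
    posSemidef_sum _ fun _ _ => posSemidef_vecMulVec_self _)

lemma Sig_ge (n : ℕ) (v : Fin d → ℝ) :
    lam * (v ⬝ᵥ v) ≤ v ⬝ᵥ (m.Sig lam x a n *ᵥ v) := by
  have h : (∑ n' ∈ Finset.Ico 1 n, ∑ h ∈ Finset.Icc 1 m.H,
      vecMulVec (m.φ (x n' h) (a n' h)) (m.φ (x n' h) (a n' h))).PosSemidef :=
    posSemidef_sum _ fun _ _ => posSemidef_sum _ fun _ _ => posSemidef_vecMulVec_self _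
  have h2 := h.dotProduct_mulVec_nonneg v
  rw [star_trivial] at h2
  rw [Sig, add_mulVec, dotProduct_add, smul_mulVec, one_mulVec, dotProduct_smul, smul_eq_mul]
  linarith

lemma Sig_one : m.Sig lam x a 1 = lam • (1 : Matrix (Fin d) (Fin d) ℝ) := by
  simp [Sig]

lemma Sig_succ {n : ℕ} (hn : 1 ≤ n) : m.Sig lam x a (n + 1) = m.Sig lam x a n
    + ∑ h ∈ Finset.Icc 1 m.H, vecMulVec (m.φ (x n h) (a n h)) (m.φ (x n h) (a n h)) := by
  rw [Sig, Sig, Finset.sum_Ico_succ_top hn, add_assoc]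

lemma det_Sig_le {Lφ : ℝ} (hφ : ∀ s a, l2norm (m.φ s a) ≤ Lφ) (hlam : 0 < lam) (hd : 0 < d)
    (n : ℕ) : (m.Sig lam x a n).det ≤ (lam + ((n - 1 : ℕ) * m.H * Lφ ^ 2) / d) ^ d := by
  have hd' : (0 : ℝ) < d := by exact_mod_cast hd
  refine ((m.Sig_posDef x a hlam n).det_le_pow_trace_div hd).trans ?_
  have htr : (m.Sig lam x a n).trace ≤ lam * d + (n - 1 : ℕ) * m.H * Lφ ^ 2 := by
    rw [Sig, trace_add, trace_smul, trace_one, trace_sum, smul_eq_mul, Fintype.card_fin]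
    refine add_le_add le_rfl ?_
    have h1 : ∀ n' ∈ Finset.Ico 1 n, (∑ h ∈ Finset.Icc 1 m.H,
        vecMulVec (m.φ (x n' h) (a n' h)) (m.φ (x n' h) (a n' h))).trace ≤ m.H * Lφ ^ 2 := by
      intro n' _
      rw [trace_sum]
      refine (Finset.sum_le_card_nsmul _ _ (Lφ ^ 2) fun h _ => ?_).trans (by simp)
      rw [trace_vecMulVec, ← l2norm_sq]
      exact pow_le_pow_left₀ (l2norm_nonneg _) (hφ _ _) 2
    refine (Finset.sum_le_card_nsmul _ _ _ h1).trans ?_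
    simp [mul_assoc]
  have h0 : 0 ≤ (m.Sig lam x a n).trace / d :=
    div_nonneg (m.Sig_posDef x a hlam n).posSemidef.trace_nonneg hd'.le
  refine pow_le_pow_left₀ h0 ?_ d
  rw [div_le_iff₀ hd', add_mul, div_mul_cancel₀ _ hd'.ne']
  exact htr

lemma log_det_Sig_le {Lφ : ℝ} (hφ : ∀ s a, l2norm (m.φ s a) ≤ Lφ) (hlam : 0 < lam) (hd : 0 < d)
    (n : ℕ) : Real.log ((m.Sig lam x a n).det) ≤
      d * Real.log lam + d * Real.log (1 + (n - 1 : ℕ) * m.H * Lφ ^ 2 / (lam * d)) := by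
  have hd' : (0 : ℝ) < d := by exact_mod_cast hd
  have h := Real.log_le_log (m.Sig_posDef x a hlam n).det_pos (m.det_Sig_le x a hφ hlam hd n)
  have h1 : lam + ((n - 1 : ℕ) * m.H * Lφ ^ 2) / d
      = lam * (1 + (n - 1 : ℕ) * m.H * Lφ ^ 2 / (lam * d)) := by
    field_simp
  rw [Real.log_pow, h1, Real.log_mul hlam.ne' (by positivity), mul_add] at h
  exact h

/-- The **elliptical potential lemma** for estimates that are updated once per episode. -/
lemma sum_min_one_weightedNorm_sq_le {Lφ : ℝ} (hφ : ∀ s a, l2norm (m.φ s a) ≤ Lφ) (hlam : 0 < lam)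
    (hd : 0 < d) (N : ℕ) :
    ∑ n ∈ Finset.Icc 1 N, min 1 (∑ h ∈ Finset.Icc 1 m.H,
        weightedNorm (m.Sig lam x a n)⁻¹ (m.φ (x n h) (a n h)) ^ 2)
      ≤ 2 * (d * Real.log (1 + N * m.H * Lφ ^ 2 / (lam * d))) := by
  have hstep : ∀ n, 1 ≤ n → min 1 (∑ h ∈ Finset.Icc 1 m.H,
      weightedNorm (m.Sig lam x a n)⁻¹ (m.φ (x n h) (a n h)) ^ 2)
      ≤ 2 * (Real.log (m.Sig lam x a (n + 1)).det - Real.log (m.Sig lam x a n).det) := by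
    intro n hn
    have hpos := m.Sig_posDef x a hlam n
    set Y := ∑ h ∈ Finset.Icc 1 m.H,
      weightedNorm (m.Sig lam x a n)⁻¹ (m.φ (x n h) (a n h)) ^ 2 with hY
    have hY0 : 0 ≤ Y := Finset.sum_nonneg fun _ _ => sq_nonneg _
    have h1 := hpos.det_mul_le_det_add_sum (Finset.Icc 1 m.H) fun h => m.φ (x n h) (a n h)
    simp only [← weightedNorm_sq hpos.inv, ← hY] at h1
    rw [← Sig_succ m x a hn] at h1
    have h2 := Real.log_le_log (mul_pos hpos.det_pos (by linarith)) h1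
    rw [Real.log_mul hpos.det_pos.ne' (by linarith)] at h2
    have h3 : 1 - (1 + Y)⁻¹ ≤ Real.log (1 + Y) := Real.one_sub_inv_le_log_of_pos (by linarith)
    have h4 : min 1 Y ≤ 2 * (1 - (1 + Y)⁻¹) := by
      have h5 : 1 - (1 + Y)⁻¹ = Y / (1 + Y) := by
        field_simp
        ring
      rw [h5, ← mul_div_assoc, le_div_iff₀ (by linarith)]
      rcases le_total Y 1 with h | h
      · rw [min_eq_right h]
        nlinarith
      · rw [min_eq_left h]
        linarith
    linarith
  have hsum : ∀ N, ∑ n ∈ Finset.Icc 1 N, min 1 (∑ h ∈ Finset.Icc 1 m.H,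
      weightedNorm (m.Sig lam x a n)⁻¹ (m.φ (x n h) (a n h)) ^ 2)
      ≤ 2 * (Real.log (m.Sig lam x a (N + 1)).det - Real.log (m.Sig lam x a 1).det) := by
    intro N
    induction N with
    | zero => simp
    | succ N ih =>
      rw [Finset.sum_Icc_succ_top (by omega)]
      have := hstep (N + 1) (by omega)
      linarith
  refine (hsum N).trans ?_
  have h1 := m.log_det_Sig_le x a hφ hlam hd (N + 1)
  rw [Nat.add_sub_cancel] at h1
  have h2 : (m.Sig lam x a 1).det = lam ^ d := by
    rw [Sig_one, det_smul, det_one, Fintype.card_fin, mul_one]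
  rw [h2, Real.log_pow]
  linarith

/-- The vector `∑ e φ` of the regression noise of coordinate `i`, over the episodes before `n`. -/
noncomputable def noiseSum (i : Fin d') (n : ℕ) : Fin d → ℝ :=
  ∑ n' ∈ Finset.Ico 1 n, ∑ h ∈ Finset.Icc 1 m.H,
    m.noiseAt i (x n' h) (a n' h) (x n' (h + 1)) • m.φ (x n' h) (a n' h)

/-- The error of the ridge estimator consists of the noise and the regularization bias. -/
lemma Mstar_sub_Mhat_col (hlam : 0 < lam) (i : Fin d') (n : ℕ) :
    (fun j => (m.Mstar - m.Mhat lam x a n) j i) =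
      (m.Sig lam x a n)⁻¹ *ᵥ (lam • (fun j => m.Mstar j i) - m.noiseSum x a i n) := by
  have hpos := m.Sig_posDef x a hlam n
  have h1 : (fun j => m.Mhat lam x a n j i) = (m.Sig lam x a n)⁻¹ *ᵥ
      (∑ n' ∈ Finset.Ico 1 n, ∑ h ∈ Finset.Icc 1 m.H,
        (m.ψ (x n' (h + 1)) ᵥ* (m.K)⁻¹) i • m.φ (x n' h) (a n' h)) := by
    have h2 : ∀ (B : Matrix (Fin d) (Fin d') ℝ), (fun j => B j i) = B *ᵥ Pi.single i 1 :=
      fun B => by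
        rw [mulVec_single_one]
        rfl
    rw [h2, Mhat, Matrix.mul_assoc, ← mulVec_mulVec]
    congr 1
    rw [← mulVec_mulVec, sum_mulVec]
    refine Finset.sum_congr rfl fun n' _ => ?_
    rw [sum_mulVec]
    refine Finset.sum_congr rfl fun h _ => ?_
    rw [vecMulVec_mulVec]
    rw [mulVec_single_one]
    ext j
    simp only [Pi.smul_apply, MulOpposite.smul_eq_mul_unop, MulOpposite.unop_op, smul_eq_mul]
    exact mul_comm _ _
  have h3 : m.Sig lam x a n *ᵥ (fun j => m.Mstar j i) = lam • (fun j => m.Mstar j i)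
      + ∑ n' ∈ Finset.Ico 1 n, ∑ h ∈ Finset.Icc 1 m.H,
        (m.φ (x n' h) (a n' h) ⬝ᵥ fun j => m.Mstar j i) • m.φ (x n' h) (a n' h) := by
    rw [Sig, add_mulVec, smul_mulVec, one_mulVec, sum_mulVec]
    congr 1
    refine Finset.sum_congr rfl fun n' _ => ?_
    rw [sum_mulVec]
    refine Finset.sum_congr rfl fun h _ => ?_
    rw [vecMulVec_mulVec]
    ext j
    simp [mul_comm]
  have h4 : (fun j => m.Mstar j i)
      = (m.Sig lam x a n)⁻¹ *ᵥ (m.Sig lam x a n *ᵥ (fun j => m.Mstar j i)) := by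
    rw [mulVec_mulVec, nonsing_inv_mul _ hpos.isUnit_det, one_mulVec]
  have h5 : (fun j => (m.Mstar - m.Mhat lam x a n) j i)
      = (fun j => m.Mstar j i) - fun j => m.Mhat lam x a n j i := by
    ext j
    simp
  rw [h5]
  conv_lhs => rw [h4, h1, ← mulVec_sub, h3]
  congr 1
  simp only [noiseSum, noiseAt, sub_smul, Finset.sum_sub_distrib]
  abel

lemma weightedNorm_Mstar_sub_Mhat_le {SM : ℝ} (hSM : ∀ i, l2norm (fun j => m.Mstar j i) ≤ SM)
    (hlam : 0 < lam) (i : Fin d') (n : ℕ) :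
    weightedNorm (m.Sig lam x a n) (fun j => (m.Mstar - m.Mhat lam x a n) j i)
      ≤ weightedNorm (m.Sig lam x a n)⁻¹ (m.noiseSum x a i n) + √lam * SM := by
  have hpos := m.Sig_posDef x a hlam n
  rw [m.Mstar_sub_Mhat_col x a hlam, weightedNorm_inv_mulVec hpos]
  refine (weightedNorm_sub_le hpos.inv _ _).trans ?_
  rw [weightedNorm_smul _ hlam.le, add_comm]
  refine add_le_add le_rfl ?_
  have h1 := weightedNorm_inv_le hpos hlam (m.Sig_ge x a n) (fun j => m.Mstar j i)
  have h2 : lam = √lam * √lam := (Real.mul_self_sqrt hlam.le).symm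
  calc lam * weightedNorm (m.Sig lam x a n)⁻¹ (fun j => m.Mstar j i)
      = √lam * (√lam * weightedNorm (m.Sig lam x a n)⁻¹ (fun j => m.Mstar j i)) := by
        rw [← mul_assoc, ← h2]
    _ ≤ √lam * SM := mul_le_mul_of_nonneg_left (h1.trans (hSM i)) (Real.sqrt_nonneg _)

/-- On the event of the self-normalized tail bound, with failure probability `δ / d'` for each
column, the column `i` of `M⋆` is within `√β_n` of the estimate. The factor `d ≥ 2` in front of
the logarithm in `β_n` pays for the two copies of `log (d' / δ)` in the tail bound. -/
lemma weightedNorm_Mstar_sub_Mhat_le_rootBeta {Lφ Lψ SM δ : ℝ} (hb : m.Bounded Lφ Lψ SM)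
    (hlam : 0 < lam) (hδ0 : 0 < δ) (hδ1 : δ < 1) (hd : 2 ≤ d) (hR : 0 < m.noise Lφ Lψ SM)
    (i : Fin d') (n : ℕ)
    (hgood : √(lam ^ d / (m.Sig lam x a n).det) *
      Real.exp (m.noiseSum x a i n ⬝ᵥ ((m.Sig lam x a n)⁻¹ *ᵥ m.noiseSum x a i n)
        / (2 * m.noise Lφ Lψ SM ^ 2)) < 1 / (δ / d')) :
    weightedNorm (m.Sig lam x a n) (fun j => (m.Mstar - m.Mhat lam x a n) j i)
      ≤ m.rootBeta Lφ Lψ SM lam δ n := by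
  have hpos := m.Sig_posDef x a hlam n
  refine (m.weightedNorm_Mstar_sub_Mhat_le x a hb.col_le hlam i n).trans
    (add_le_add ?_ le_rfl)
  set R := m.noise Lφ Lψ SM with hRdef
  have hd'1 : (1 : ℝ) ≤ d' := by exact_mod_cast i.pos
  have hd'0 : (0 : ℝ) < d' := by linarith
  have hd2 : (2 : ℝ) ≤ d := by exact_mod_cast hd
  rw [weightedNorm]
  set V := m.noiseSum x a i n ⬝ᵥ ((m.Sig lam x a n)⁻¹ *ᵥ m.noiseSum x a i n) with hV
  set κ := n * m.H * Lφ ^ 2 / lam with hκ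
  have hκ0 : 0 ≤ κ := by positivity
  have hL : (d' + d' * n * m.H * Lφ ^ 2 / lam) / δ = (1 + κ) * (d' / δ) := by
    rw [hκ]
    field_simp
  have hlog : Real.log ((m.Sig lam x a n).det) ≤ d * Real.log lam + d * Real.log (1 + κ) := by
    refine (m.log_det_Sig_le x a hb.phi_le hlam (by omega) n).trans ?_
    refine add_le_add le_rfl (mul_le_mul_of_nonneg_left ?_ (by positivity))
    refine Real.log_le_log (by positivity) (add_le_add le_rfl ?_)
    rw [hκ]
    have h1 : ((n - 1 : ℕ) : ℝ) ≤ n := by exact_mod_cast Nat.sub_le _ _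
    have h2 : lam ≤ lam * d := le_mul_of_one_le_right hlam.le (by linarith)
    gcongr
  have hsq : √(lam ^ d / (m.Sig lam x a n).det)
      = Real.exp ((d * Real.log lam - Real.log ((m.Sig lam x a n).det)) / 2) := by
    rw [Real.sqrt_eq_rpow, Real.rpow_def_of_pos (div_pos (pow_pos hlam d) hpos.det_pos),
      Real.log_div (pow_pos hlam d).ne' hpos.det_pos.ne', Real.log_pow]
    congr 1
    ring
  rw [hsq, ← Real.exp_add, one_div_div, ← Real.lt_log_iff_exp_lt (by positivity)] at hgood
  have hlogd : 0 ≤ Real.log (d' / δ) := by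
    refine Real.log_nonneg ?_
    rw [le_div_iff₀ hδ0]
    linarith
  have hVle : V ≤ R ^ 2 * (d * Real.log ((d' + d' * n * m.H * Lφ ^ 2 / lam) / δ)) := by
    rw [hL, Real.log_mul (by positivity) (by positivity)]
    have h1 : V / (2 * R ^ 2) ≤ (d * (Real.log (1 + κ) + Real.log (d' / δ))) / 2 := by
      nlinarith
    rw [div_le_iff₀ (by positivity)] at h1
    linarith
  calc √V ≤ √(R ^ 2 * (d * Real.log ((d' + d' * n * m.H * Lφ ^ 2 / lam) / δ))) :=
        Real.sqrt_le_sqrt hVle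
    _ = R * √(d * Real.log ((d' + d' * n * m.H * Lφ ^ 2 / lam) / δ)) := by
        rw [Real.sqrt_mul (sq_nonneg _), Real.sqrt_sq hR.le]

/-- Hölder's inequality over the columns, with the dual norms of `Σ_n` on each of them. -/
lemma abs_dotProduct_mulVec_le (hlam : 0 < lam) (n : ℕ) (u : Fin d → ℝ)
    (B : Matrix (Fin d) (Fin d') ℝ) (w : Fin d' → ℝ) :
    |u ⬝ᵥ (B *ᵥ w)| ≤ weightedNorm (m.Sig lam x a n)⁻¹ u *
      ∑ i, |w i| * weightedNorm (m.Sig lam x a n) (fun j => B j i) := by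
  have h : u ⬝ᵥ (B *ᵥ w) = ∑ i, w i * (u ⬝ᵥ fun j => B j i) := by
    simp only [mulVec, dotProduct, Finset.mul_sum]
    rw [Finset.sum_comm]
    exact Finset.sum_congr rfl fun i _ => Finset.sum_congr rfl fun j _ => by ring
  rw [h, Finset.mul_sum]
  refine (Finset.abs_sum_le_sum_abs _ _).trans (Finset.sum_le_sum fun i _ => ?_)
  rw [abs_mul, mul_left_comm]
  exact mul_le_mul_of_nonneg_left
    (abs_dotProduct_le_weightedNorm (m.Sig_posDef x a hlam n) _ _) (abs_nonneg _)

end Trajectory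

lemma noise_nonneg (m : MatrixMDP St Act d d') {Lφ Lψ SM : ℝ} (hφ : 0 ≤ Lφ) (hψ : 0 ≤ Lψ)
    (hSM : 0 ≤ SM) : 0 ≤ m.noise Lφ Lψ SM := by
  unfold noise
  positivity

lemma rootBeta_nonneg (m : MatrixMDP St Act d d') {Lφ Lψ SM lam δ : ℝ}
    (hR : 0 ≤ m.noise Lφ Lψ SM) (hSM : 0 ≤ SM) (n : ℕ) :
    0 ≤ m.rootBeta Lφ Lψ SM lam δ n := by
  unfold rootBeta
  positivity

lemma rootBeta_mono (m : MatrixMDP St Act d d') {Lφ Lψ SM lam δ : ℝ}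
    (hR : 0 ≤ m.noise Lφ Lψ SM) (hd' : 0 < d') (hlam : 0 < lam) (hδ0 : 0 < δ) {n N : ℕ}
    (hn : n ≤ N) : m.rootBeta Lφ Lψ SM lam δ n ≤ m.rootBeta Lφ Lψ SM lam δ N := by
  have hd'0 : (0 : ℝ) < d' := by exact_mod_cast hd'
  have hn' : (n : ℝ) ≤ N := by exact_mod_cast hn
  unfold rootBeta
  refine add_le_add (mul_le_mul_of_nonneg_left (Real.sqrt_le_sqrt
    (mul_le_mul_of_nonneg_left (Real.log_le_log (by positivity) ?_) (by positivity))) hR) le_rfl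
  gcongr

end MatrixMDP

/-! ### Optimism and the regret of one episode -/

namespace MatrixMDP

variable {St Act : Type*} [Fintype St] {d d' : ℕ} (m : MatrixMDP St Act d d')

lemma sum_P_mul_nonneg (s : St) (a : Act) {V : St → ℝ} (hV : ∀ s, 0 ≤ V s) :
    0 ≤ ∑ s', m.P s a s' * V s' :=
  Finset.sum_nonneg fun s' _ => mul_nonneg (m.P_nonneg s a s') (hV s')

lemma sum_P_mul_mono (s : St) (a : Act) {V W : St → ℝ} (h : ∀ s, V s ≤ W s) :
    ∑ s', m.P s a s' * V s' ≤ ∑ s', m.P s a s' * W s' :=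
  Finset.sum_le_sum fun s' _ => mul_le_mul_of_nonneg_left (h s') (m.P_nonneg s a s')

lemma sum_P_mul_le (s : St) (a : Act) {V : St → ℝ} {c : ℝ} (hV : ∀ s, V s ≤ c) :
    ∑ s', m.P s a s' * V s' ≤ c := by
  refine (m.sum_P_mul_mono s a hV).trans_eq ?_
  rw [← Finset.sum_mul, m.P_sum, one_mul]

lemma valueToGo_nonneg (π : ℕ → St → Act) (k : ℕ) (s : St) : 0 ≤ m.valueToGo π k s := by
  induction k generalizing s with
  | zero => simp [valueToGo]
  | succ k ih =>
    rw [valueToGo]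
    exact add_nonneg (m.r_mem _ _).1 (m.sum_P_mul_nonneg _ _ ih)

lemma valueToGo_le (π : ℕ → St → Act) (k : ℕ) (s : St) : m.valueToGo π k s ≤ k := by
  induction k generalizing s with
  | zero => simp [valueToGo]
  | succ k ih =>
    rw [valueToGo]
    push_cast
    rw [add_comm]
    exact add_le_add (m.sum_P_mul_le _ _ ih) (m.r_mem _ _).2

lemma value_one (π : ℕ → St → Act) (s : St) : m.value π 1 s = m.valueToGo π m.H s := by
  rw [value, Nat.add_sub_cancel]

lemma optValue_sub_value_le_H (π : ℕ → St → Act) (s : St) :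
    m.optValue s - m.value π 1 s ≤ m.H := by
  have : Nonempty (ℕ → St → Act) := ⟨π⟩
  have h1 : m.optValue s ≤ m.H := ciSup_le fun π' => by
    rw [value_one]
    exact m.valueToGo_le π' m.H s
  have h2 := m.valueToGo_nonneg π m.H s
  rw [value_one]
  linarith

lemma abs_optimisticV_le (U : Set (Matrix (Fin d) (Fin d') ℝ)) (k : ℕ) (s : St) :
    |m.optimisticV U k s| ≤ m.H := by
  cases k with
  | zero => simp [optimisticV]
  | succ k =>
    rw [optimisticV, abs_of_nonneg (le_max_left _ _)]
    exact max_le (Nat.cast_nonneg _) (min_le_left _ _)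

/-- With `k` stages left, the expected sum of the bonuses `g ‖φ‖_{Σ⁻¹}` that the policy `π`
collects, truncated at `H` in each stage. It dominates the gap between the optimistic value
function and the value of `π`, and it is a measurable function of the data and the policy. -/
noncomputable def bonusValue (Sg : Matrix (Fin d) (Fin d) ℝ) (g : ℝ) (π : ℕ → St → Act) :
    ℕ → St → ℝ
  | 0 => fun _ => 0
  | k + 1 => fun s => min (m.H : ℝ) (g * weightedNorm Sg⁻¹ (m.φ s (π (m.H - k) s)) +
      ∑ s', m.P s (π (m.H - k) s) s' * bonusValue Sg g π k s')

lemma bonusValue_nonneg (Sg : Matrix (Fin d) (Fin d) ℝ) {g : ℝ} (hg : 0 ≤ g)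
    (π : ℕ → St → Act) (k : ℕ) (s : St) : 0 ≤ m.bonusValue Sg g π k s := by
  induction k generalizing s with
  | zero => simp [bonusValue]
  | succ k ih =>
    rw [bonusValue]
    exact le_min (Nat.cast_nonneg _) (add_nonneg (mul_nonneg hg (weightedNorm_nonneg _ _))
      (m.sum_P_mul_nonneg _ _ ih))

lemma bonusValue_le_H (Sg : Matrix (Fin d) (Fin d) ℝ) (g : ℝ) (π : ℕ → St → Act) (k : ℕ)
    (s : St) : m.bonusValue Sg g π k s ≤ m.H := by
  cases k with
  | zero => simp [bonusValue]
  | succ k => exact min_le_left _ _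

section Optimism

variable {U : Set (Matrix (Fin d) (Fin d') ℝ)} {Sg : Matrix (Fin d) (Fin d) ℝ} {g : ℝ}
  {π : ℕ → St → Act} {V : St → ℝ}

/-- The set `U` has width at most `g` with respect to `M⋆`, in every direction `φ(s,a)` and for
every value function: `|φᵀ (M - M⋆) Ψᵀ V| ≤ g ‖φ‖_{Σ⁻¹}` for `M ∈ U`. -/
def HasWidth (U : Set (Matrix (Fin d) (Fin d') ℝ)) (Sg : Matrix (Fin d) (Fin d) ℝ) (g : ℝ) :
    Prop :=
  ∀ M ∈ U, ∀ s a, ∀ V : St → ℝ, (∀ s, |V s| ≤ m.H) →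
    |m.φ s a ⬝ᵥ ((M - m.Mstar) *ᵥ (m.Psiᵀ *ᵥ V))| ≤ g * weightedNorm Sg⁻¹ (m.φ s a)

lemma HasWidth.apply_le {m : MatrixMDP St Act d d'} (h : m.HasWidth U Sg g)
    (hV : ∀ s, |V s| ≤ m.H) {M : Matrix (Fin d) (Fin d') ℝ} (hM : M ∈ U) (s : St) (a : Act) :
    m.φ s a ⬝ᵥ (M *ᵥ (m.Psiᵀ *ᵥ V))
      ≤ ∑ s', m.P s a s' * V s' + g * weightedNorm Sg⁻¹ (m.φ s a) := by
  have h1 := (le_abs_self _).trans (h M hM s a V hV)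
  rw [sub_mulVec, dotProduct_sub, ← m.sum_P_mul_eq] at h1
  linarith

lemma le_backup {m : MatrixMDP St Act d d'} (hU : m.Mstar ∈ U) (h : m.HasWidth U Sg g)
    (hV : ∀ s, |V s| ≤ m.H) (s : St) (a : Act) :
    m.r s a + ∑ s', m.P s a s' * V s' ≤ m.backup U V s a := by
  refine add_le_add le_rfl ?_
  rw [sum_P_mul_eq]
  refine le_csSup ⟨∑ s', m.P s a s' * V s' + g * weightedNorm Sg⁻¹ (m.φ s a), ?_⟩
    ⟨m.Mstar, hU, rfl⟩
  rintro _ ⟨M, hM, rfl⟩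
  exact h.apply_le hV hM s a

lemma backup_le {m : MatrixMDP St Act d d'} (hU : m.Mstar ∈ U) (h : m.HasWidth U Sg g)
    (hV : ∀ s, |V s| ≤ m.H) (s : St) (a : Act) :
    m.backup U V s a
      ≤ m.r s a + (∑ s', m.P s a s' * V s' + g * weightedNorm Sg⁻¹ (m.φ s a)) := by
  refine add_le_add le_rfl (csSup_le ⟨_, m.Mstar, hU, rfl⟩ ?_)
  rintro _ ⟨M, hM, rfl⟩
  exact h.apply_le hV hM s a

/-- The policy `π` plays maximizers of the optimistic `Q` function. -/
def IsGreedy (U : Set (Matrix (Fin d) (Fin d') ℝ)) (π : ℕ → St → Act) : Prop :=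
  ∀ h ∈ Set.Icc 1 m.H, ∀ s b, m.optimisticQ U h s b ≤ m.optimisticQ U h s (π h s)

lemma IsGreedy.backup_le {m : MatrixMDP St Act d d'} (hπ : m.IsGreedy U π) {k : ℕ}
    (hk : k < m.H) (s : St) (b : Act) : m.backup U (m.optimisticV U k) s b
      ≤ m.backup U (m.optimisticV U k) s (π (m.H - k) s) := by
  have h := hπ (m.H - k) ⟨by omega, by omega⟩ s b
  rwa [optimisticQ, optimisticQ, Nat.sub_sub_self hk.le] at h

lemma IsGreedy.optimisticV_succ {m : MatrixMDP St Act d d'} (hπ : m.IsGreedy U π) {k : ℕ}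
    (hk : k < m.H) (s : St) : m.optimisticV U (k + 1) s =
      max 0 (min (m.H : ℝ) (m.backup U (m.optimisticV U k) s (π (m.H - k) s))) := by
  have : Nonempty Act := ⟨π 0 s⟩
  have hsup : ⨆ a, m.backup U (m.optimisticV U k) s a
      = m.backup U (m.optimisticV U k) s (π (m.H - k) s) :=
    le_antisymm (ciSup_le fun b => hπ.backup_le hk s b)
      (le_ciSup (f := fun a => m.backup U (m.optimisticV U k) s a)
        ⟨_, Set.forall_mem_range.mpr fun b => hπ.backup_le hk s b⟩ _)
  simp only [optimisticV, hsup]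

/-- Optimism: the optimistic value function dominates the value of every policy. -/
lemma valueToGo_le_optimisticV {m : MatrixMDP St Act d d'} (hU : m.Mstar ∈ U)
    (hw : m.HasWidth U Sg g) (hπ : m.IsGreedy U π) (π' : ℕ → St → Act) {k : ℕ} (hk : k ≤ m.H)
    (s : St) : m.valueToGo π' k s ≤ m.optimisticV U k s := by
  induction k generalizing s with
  | zero => simp [valueToGo, optimisticV]
  | succ k ih =>
    rw [hπ.optimisticV_succ hk]
    refine le_max_of_le_right (le_min ?_ ?_)
    · exact (m.valueToGo_le π' _ s).trans (by exact_mod_cast hk)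
    · refine le_trans ?_ (hπ.backup_le hk s (π' (m.H - k) s))
      refine le_trans ?_ (le_backup hU hw (m.abs_optimisticV_le U k) s _)
      rw [valueToGo]
      exact add_le_add le_rfl (m.sum_P_mul_mono _ _ fun s' => ih (by omega) s')

lemma optimisticV_sub_valueToGo_le {m : MatrixMDP St Act d d'} (hU : m.Mstar ∈ U)
    (hw : m.HasWidth U Sg g) (hg : 0 ≤ g) (hπ : m.IsGreedy U π) {k : ℕ} (hk : k ≤ m.H)
    (s : St) :
    m.optimisticV U k s - m.valueToGo π k s ≤ m.bonusValue Sg g π k s := by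
  induction k generalizing s with
  | zero => simp [valueToGo, optimisticV, bonusValue]
  | succ k ih =>
    have h0 := m.bonusValue_nonneg Sg hg π (k + 1) s
    have h1 := m.valueToGo_nonneg π (k + 1) s
    rw [hπ.optimisticV_succ hk]
    have h2 := backup_le hU hw (m.abs_optimisticV_le U k) s (π (m.H - k) s)
    set B := m.backup U (m.optimisticV U k) s (π (m.H - k) s) with hB
    rcases le_total (min (m.H : ℝ) B) 0 with h | h
    · rw [max_eq_left h]
      linarith
    · rw [max_eq_right h, bonusValue]
      refine le_min ?_ ?_
      · have := min_le_left (m.H : ℝ) B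
        linarith
      · have h3 := min_le_right (m.H : ℝ) B
        have h4 := m.sum_P_mul_mono s (π (m.H - k) s) fun s' => ih (by omega) s'
        simp only [mul_sub, Finset.sum_sub_distrib] at h4
        rw [valueToGo]
        linarith

lemma optValue_sub_value_le_bonusValue {m : MatrixMDP St Act d d'} (hU : m.Mstar ∈ U)
    (hw : m.HasWidth U Sg g) (hg : 0 ≤ g) (hπ : m.IsGreedy U π) (s : St) :
    m.optValue s - m.value π 1 s ≤ m.bonusValue Sg g π m.H s := by
  have : Nonempty (ℕ → St → Act) := ⟨π⟩
  have h1 : m.optValue s ≤ m.optimisticV U m.H s := ciSup_le fun π' => by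
    rw [value_one]
    exact valueToGo_le_optimisticV hU hw hπ π' le_rfl s
  have h2 := optimisticV_sub_valueToGo_le hU hw hg hπ le_rfl s
  rw [value_one]
  linarith

end Optimism

/-- The difference between the expected and the actual value of `bonusValue` at the state
after stage `h`. -/
noncomputable def bonusNoise (Sg : Matrix (Fin d) (Fin d) ℝ) (g : ℝ) (π : ℕ → St → Act) (h : ℕ)
    (s : St) (s' : St) : ℝ :=
  ∑ s'', m.P s (π h s) s'' * m.bonusValue Sg g π (m.H - h) s''
    - m.bonusValue Sg g π (m.H - h) s'

lemma sum_P_mul_bonusNoise (Sg : Matrix (Fin d) (Fin d) ℝ) (g : ℝ) (π : ℕ → St → Act) (h : ℕ)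
    (s : St) : ∑ s', m.P s (π h s) s' * m.bonusNoise Sg g π h s s' = 0 := by
  simp only [bonusNoise, mul_sub, Finset.sum_sub_distrib, ← Finset.sum_mul, m.P_sum, one_mul,
    sub_self]

lemma abs_bonusNoise_le (Sg : Matrix (Fin d) (Fin d) ℝ) {g : ℝ} (hg : 0 ≤ g)
    (π : ℕ → St → Act) (h : ℕ) (s s' : St) : |m.bonusNoise Sg g π h s s'| ≤ m.H := by
  have h0 := m.bonusValue_nonneg Sg hg π (m.H - h)
  have h1 := m.bonusValue_le_H Sg g π (m.H - h)
  have h2 := m.sum_P_mul_nonneg s (π h s) h0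
  have h3 := m.sum_P_mul_le s (π h s) h1
  have h4 := h0 s'
  have h5 := h1 s'
  rw [bonusNoise, abs_le]
  constructor <;> linarith

/-- The value function `bonusValue` along a trajectory is at most the sum of the truncated bonuses
met on the way, plus a martingale. -/
lemma bonusValue_le_sum (Sg : Matrix (Fin d) (Fin d) ℝ) {g : ℝ} (hg : 0 ≤ g)
    (π : ℕ → St → Act) (x : ℕ → St) :
    m.bonusValue Sg g π m.H (x 1) ≤ ∑ h ∈ Finset.Icc 1 m.H,
      (min (m.H : ℝ) (g * weightedNorm Sg⁻¹ (m.φ (x h) (π h (x h))))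
        + m.bonusNoise Sg g π h (x h) (x (h + 1))) := by
  have key : ∀ k ≤ m.H, m.bonusValue Sg g π m.H (x 1) ≤ ∑ h ∈ Finset.Icc 1 k,
      (min (m.H : ℝ) (g * weightedNorm Sg⁻¹ (m.φ (x h) (π h (x h))))
        + m.bonusNoise Sg g π h (x h) (x (h + 1))) + m.bonusValue Sg g π (m.H - k) (x (k + 1)) := by
    intro k
    induction k with
    | zero => simp
    | succ k ih =>
      intro hk
      rw [Finset.sum_Icc_succ_top (by omega)]
      refine (ih (by omega)).trans ?_
      rw [add_assoc]
      refine add_le_add le_rfl ?_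
      have h1 : m.H - k = (m.H - (k + 1)) + 1 := by omega
      have h2 : m.H - (m.H - (k + 1)) = k + 1 := by omega
      rw [h1, bonusValue, h2, bonusNoise]
      have h3 := m.sum_P_mul_nonneg (x (k + 1)) (π (k + 1) (x (k + 1)))
        (m.bonusValue_nonneg Sg hg π (m.H - (k + 1)))
      set p := ∑ s', m.P (x (k + 1)) (π (k + 1) (x (k + 1))) s'
        * m.bonusValue Sg g π (m.H - (k + 1)) s'
      set b := g * weightedNorm Sg⁻¹ (m.φ (x (k + 1)) (π (k + 1) (x (k + 1))))
      have h4 : min (m.H : ℝ) (b + p) ≤ min (m.H : ℝ) b + p := by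
        rw [← min_add_add_right]
        exact min_le_min (by linarith) le_rfl
      linarith
  simpa [bonusValue] using key m.H le_rfl

/-! ### Summation of the bonuses -/

lemma sum_le_sqrt_card_mul_sum_sq {ι : Type*} (s : Finset ι) (f : ι → ℝ) :
    ∑ i ∈ s, f i ≤ √(s.card * ∑ i ∈ s, f i ^ 2) :=
  Real.le_sqrt_of_sq_le sq_sum_le_card_mul_sum_sq

/-- Episodes with `∑ w² ≤ 1` are handled by the Cauchy–Schwarz inequality, and the remaining ones
cost at most `H²` each. -/
lemma sum_min_mul_le {H N : ℕ} {g : ℝ} (hg : 0 ≤ g) (w : ℕ → ℕ → ℝ) :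
    ∑ n ∈ Finset.Icc 1 N, ∑ h ∈ Finset.Icc 1 H, min (H : ℝ) (g * w n h)
      ≤ g * √(N * H * ∑ n ∈ Finset.Icc 1 N, min 1 (∑ h ∈ Finset.Icc 1 H, w n h ^ 2))
        + H ^ 2 * ∑ n ∈ Finset.Icc 1 N, min 1 (∑ h ∈ Finset.Icc 1 H, w n h ^ 2) := by
  set Y : ℕ → ℝ := fun n => ∑ h ∈ Finset.Icc 1 H, w n h ^ 2 with hY
  have hY0 : ∀ n, 0 ≤ Y n := fun n => Finset.sum_nonneg fun _ _ => sq_nonneg _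
  have h1 : ∀ n ∈ Finset.Icc 1 N, ∑ h ∈ Finset.Icc 1 H, min (H : ℝ) (g * w n h)
      ≤ g * √(H * min 1 (Y n)) + H ^ 2 * min 1 (Y n) := by
    intro n _
    rcases le_total (Y n) 1 with h | h
    · rw [min_eq_right h]
      have h2 : ∑ h ∈ Finset.Icc 1 H, min (H : ℝ) (g * w n h)
          ≤ g * ∑ h ∈ Finset.Icc 1 H, w n h := by
        rw [Finset.mul_sum]
        exact Finset.sum_le_sum fun h _ => min_le_right _ _
      have h3 := mul_le_mul_of_nonneg_left
        (sum_le_sqrt_card_mul_sum_sq (Finset.Icc 1 H) (w n)) hg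
      rw [Nat.card_Icc, Nat.add_sub_cancel] at h3
      have h4 : 0 ≤ (H : ℝ) ^ 2 * Y n := mul_nonneg (by positivity) (hY0 n)
      linarith
    · rw [min_eq_left h]
      have h2 : ∑ h ∈ Finset.Icc 1 H, min (H : ℝ) (g * w n h) ≤ (H : ℝ) ^ 2 := by
        refine (Finset.sum_le_card_nsmul _ _ (H : ℝ) fun h _ => min_le_left _ _).trans_eq ?_
        simp [pow_two]
      have h3 : 0 ≤ g * √((H : ℝ) * 1) := by positivity
      linarith
  refine (Finset.sum_le_sum h1).trans ?_
  rw [Finset.sum_add_distrib, ← Finset.mul_sum, ← Finset.mul_sum]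
  refine add_le_add (mul_le_mul_of_nonneg_left ?_ hg) le_rfl
  refine (sum_le_sqrt_card_mul_sum_sq _ _).trans (le_of_eq ?_)
  have h2 : ∀ n, √((H : ℝ) * min 1 (Y n)) ^ 2 = H * min 1 (Y n) := fun n =>
    Real.sq_sqrt (mul_nonneg (Nat.cast_nonneg _) (le_min zero_le_one (hY0 n)))
  simp only [h2]
  rw [Nat.card_Icc, Nat.add_sub_cancel, ← Finset.mul_sum, mul_assoc]

/-- The bounds for the martingale and for the bonuses add up to the regret bound. For `N ≤ 64 H`
its first term exceeds the trivial bound `N H`; for larger `N` the episodes with a large bonus are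
absorbed by the second term, since `g` is large. -/
lemma le_regretBound {Lφ lam δ g reg : ℝ} {N : ℕ} (hN : 2 ≤ N * m.H) (hL : 0 ≤ Lφ)
    (hlam : 0 < lam) (hδ0 : 0 < δ) (hδ1 : δ < 1) (hg0 : 0 ≤ g)
    (hg : 2 * m.H * √(d * Real.log (1 + N * m.H * Lφ ^ 2 / (lam * d))) ≤ g)
    (h1 : reg ≤ N * m.H)
    (h2 : reg ≤ m.H * √(2 * (N * m.H : ℕ) * Real.log (1 / δ))
      + (g * √(N * m.H * (2 * (d * Real.log (1 + N * m.H * Lφ ^ 2 / (lam * d)))))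
        + m.H ^ 2 * (2 * (d * Real.log (1 + N * m.H * Lφ ^ 2 / (lam * d)))))) :
    reg ≤ m.regretBound Lφ lam δ (g ^ 2) N := by
  set D := d * Real.log (1 + N * m.H * Lφ ^ 2 / (lam * d)) with hD
  have hlog0 : 0 ≤ Real.log (1 + N * m.H * Lφ ^ 2 / (lam * d)) :=
    Real.log_nonneg (le_add_of_nonneg_right (by positivity))
  have hD0 : 0 ≤ D := mul_nonneg (Nat.cast_nonneg _) hlog0
  have hthird : 0 ≤ 2 * Lφ * m.H * d * √(g ^ 2 / lam)
      * Real.log (1 + N * Lφ ^ 2 / (lam * d)) := by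
    have : 0 ≤ Real.log (1 + N * Lφ ^ 2 / (lam * d)) :=
      Real.log_nonneg (le_add_of_nonneg_right (by positivity))
    positivity
  have hsecond : 2 * √(2 * g ^ 2 * N * m.H * d
      * Real.log (1 + N * m.H * Lφ ^ 2 / (lam * d))) = 2 * (g * √(N * m.H * (2 * D))) := by
    have : 2 * g ^ 2 * N * m.H * d * Real.log (1 + N * m.H * Lφ ^ 2 / (lam * d))
        = g ^ 2 * (N * m.H * (2 * D)) := by
      rw [hD]
      ring
    rw [this, Real.sqrt_mul (sq_nonneg g), Real.sqrt_sq hg0]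
  have hHpos : 0 < m.H := Nat.pos_of_ne_zero fun h => by simp [h] at hN
  have hH1 : (1 : ℝ) ≤ m.H := by exact_mod_cast hHpos
  have hT2 : (2 : ℝ) ≤ N * m.H := by exact_mod_cast hN
  -- the logarithm in the first term exceeds both `1` and `log (1 / δ)`
  have hlogT : 0.6931471803 < Real.log (N * m.H) :=
    Real.log_two_gt_d9.trans_le (Real.log_le_log two_pos hT2)
  have hlogδ : 0 ≤ Real.log (1 / δ) := Real.log_nonneg (by rw [le_div_iff₀ hδ0]; linarith)
  have hfirst : 1 + Real.log (1 / δ) ≤ Real.log (6 * Real.log (N * m.H) / δ) := by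
    have h3 : 6 * Real.log (N * m.H) / δ = 6 * Real.log (N * m.H) * (1 / δ) := by ring
    rw [h3, Real.log_mul (by linarith) (by positivity)]
    refine add_le_add ?_ le_rfl
    rw [Real.le_log_iff_exp_le (by linarith)]
    have := Real.exp_one_lt_d9
    linarith
  rw [regretBound, hsecond]
  have hbonus : 0 ≤ g * √(N * m.H * (2 * D)) := by positivity
  rcases le_or_gt (N : ℝ) (64 * m.H) with hcase | hcase
  · have h3 : (N : ℝ) * m.H
        ≤ 8 * m.H * √(N * m.H * Real.log (6 * Real.log (N * m.H) / δ)) := by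
      have h4 : (N : ℝ) / 8 ≤ √(N * m.H * Real.log (6 * Real.log (N * m.H) / δ)) := by
        apply Real.le_sqrt_of_sq_le
        have h5 : (N : ℝ) * m.H * 1 ≤ N * m.H * Real.log (6 * Real.log (N * m.H) / δ) :=
          mul_le_mul_of_nonneg_left (by linarith) (by positivity)
        have h6 : (N : ℝ) * N ≤ N * (64 * m.H) := mul_le_mul_of_nonneg_left hcase (by positivity)
        nlinarith
      have h5 := mul_le_mul_of_nonneg_left h4 (show (0 : ℝ) ≤ 8 * m.H by positivity)
      linarith
    linarith
  · have h3 : m.H * √(2 * (N * m.H : ℕ) * Real.log (1 / δ))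
        ≤ 8 * m.H * √(N * m.H * Real.log (6 * Real.log (N * m.H) / δ)) := by
      have h4 : √(2 * (N * m.H : ℕ) * Real.log (1 / δ))
          ≤ 8 * √(N * m.H * Real.log (6 * Real.log (N * m.H) / δ)) := by
        have h5 : √(2 * (N * m.H : ℕ) * Real.log (1 / δ))
            ≤ √(8 ^ 2 * (N * m.H * Real.log (6 * Real.log (N * m.H) / δ))) := by
          apply Real.sqrt_le_sqrt
          push_cast
          have h6 : (N : ℝ) * m.H * Real.log (1 / δ)
              ≤ N * m.H * Real.log (6 * Real.log (N * m.H) / δ) :=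
            mul_le_mul_of_nonneg_left (by linarith) (by positivity)
          have h7 : 0 ≤ (N : ℝ) * m.H * Real.log (1 / δ) := by positivity
          linarith
        rwa [Real.sqrt_mul (show (0 : ℝ) ≤ 8 ^ 2 by norm_num),
          Real.sqrt_sq (by norm_num)] at h5
      have h5 := mul_le_mul_of_nonneg_left h4 (show (0 : ℝ) ≤ m.H by positivity)
      linarith
    have h4 : (m.H : ℝ) ^ 2 * (2 * D) ≤ g * √(N * m.H * (2 * D)) := by
      have h5 : (m.H : ℝ) * √D ≤ √(N * m.H * (2 * D)) := by
        apply Real.le_sqrt_of_sq_le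
        rw [mul_pow, Real.sq_sqrt hD0]
        have h6 : (m.H : ℝ) ^ 2 ≤ N * m.H * 2 := by nlinarith
        nlinarith
      calc (m.H : ℝ) ^ 2 * (2 * D) = (2 * m.H * √D) * (m.H * √D) := by
            have := Real.mul_self_sqrt hD0
            linear_combination (-2 * (m.H : ℝ) ^ 2) * this
        _ ≤ g * √(N * m.H * (2 * D)) :=
            mul_le_mul hg h5 (by positivity) hg0
    linarith

/-! ### One-dimensional features -/

/-- In dimension one the normalization of the transition probabilities forces `φ` to be
constant. -/
lemma phi_eq_of_one_dim (m : MatrixMDP St Act 1 d') (s s₂ : St) (a a₂ : Act) :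
    m.φ s a = m.φ s₂ a₂ := by
  have h : ∀ s a, m.φ s a 0 * ∑ s', (m.Mstar *ᵥ m.ψ s') 0 = 1 := fun s a => by
    rw [← m.P_sum s a, Finset.mul_sum]
    refine Finset.sum_congr rfl fun s' _ => ?_
    rw [m.P_eq]
    simp [dotProduct]
  ext i
  rw [Subsingleton.elim i 0]
  have h0 : ∑ s', (m.Mstar *ᵥ m.ψ s') 0 ≠ 0 := fun h0 => by
    have := h s a
    simp [h0] at this
  exact mul_right_cancel₀ h0 ((h s a).trans (h s₂ a₂).symm)

/-- If `φ` is constant then neither the transitions nor the bonuses depend on the action, and a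
greedy policy is optimal whatever the set `U` is. -/
lemma optValue_le_value_of_phi_const {U : Set (Matrix (Fin d) (Fin d') ℝ)} {π : ℕ → St → Act}
    (hφ : ∀ s s₂ a a₂, m.φ s a = m.φ s₂ a₂) (hπ : m.IsGreedy U π) (s : St) :
    m.optValue s ≤ m.value π 1 s := by
  have : Nonempty (ℕ → St → Act) := ⟨π⟩
  refine ciSup_le fun π' => ?_
  rw [value_one, value_one]
  have key : ∀ k ≤ m.H, ∀ s, m.valueToGo π' k s ≤ m.valueToGo π k s := by
    intro k
    induction k with
    | zero => simp [valueToGo]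
    | succ k ih =>
      intro hk s
      rw [valueToGo, valueToGo]
      have hP : ∀ s', m.P s (π' (m.H - k) s) s' = m.P s (π (m.H - k) s) s' := fun s' => by
        rw [m.P_eq, m.P_eq, hφ]
      simp only [hP]
      refine add_le_add ?_ (m.sum_P_mul_mono _ _ fun s' => ih (by omega) s')
      have h := hπ.backup_le hk s (π' (m.H - k) s)
      rw [backup, backup, hφ s s (π' (m.H - k) s) (π (m.H - k) s)] at h
      linarith
  exact key m.H le_rfl s

lemma regretBound_nonneg {Lφ lam δ γ : ℝ} {N : ℕ} (hL : 0 ≤ Lφ) (hlam : 0 < lam) :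
    0 ≤ m.regretBound Lφ lam δ γ N := by
  have : 0 ≤ Real.log (1 + N * Lφ ^ 2 / (lam * d)) :=
    Real.log_nonneg (le_add_of_nonneg_right (by positivity))
  unfold regretBound
  positivity

end MatrixMDP

/-! ### The interaction as a transition process -/

lemma sum_range_eq_sum_Icc_one {M : Type*} [AddCommMonoid M] (H : ℕ) (f : ℕ → M) :
    ∑ j ∈ Finset.range H, f (j + 1) = ∑ h ∈ Finset.Icc 1 H, f h := by
  induction H with
  | zero => simp
  | succ H ih => rw [Finset.sum_range_succ, ih, Finset.sum_Icc_succ_top (by omega)]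

/-- Enumeration of the pairs (episode, stage) by a single time index. -/
lemma sum_range_mul_eq_sum_Icc {M : Type*} [AddCommMonoid M] (N H : ℕ) (f : ℕ → ℕ → M) :
    ∑ t ∈ Finset.range (N * H), f (t / H + 1) (t % H + 1)
      = ∑ n ∈ Finset.Icc 1 N, ∑ h ∈ Finset.Icc 1 H, f n h := by
  induction N with
  | zero => simp
  | succ N ih =>
    rw [Nat.succ_mul, Finset.sum_range_add, ih, Finset.sum_Icc_succ_top (by omega)]
    congr 1
    rw [← sum_range_eq_sum_Icc_one]
    refine Finset.sum_congr rfl fun j hj => ?_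
    have hj' := Finset.mem_range.mp hj
    rw [mul_comm N H, Nat.mul_add_div (by omega), Nat.div_eq_of_lt hj', Nat.mul_add_mod,
      Nat.mod_eq_of_lt hj', add_zero]

namespace MatrixMDP

variable {St Act : Type*} {d d' : ℕ} {Ω : Type*} [MeasurableSpace Act]

section History

variable [MeasurableSpace St] {H : ℕ} {x : ℕ → ℕ → Ω → St} {π : ℕ → Ω → ℕ → St → Act} {n h l k : ℕ}

lemma measurable_policy_history (hl : l ∈ Set.Icc 1 n) (hk : k ∈ Set.Icc 1 H) :
    Measurable[history H x π n h] fun ω => π l ω k := by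
  refine Measurable.mono (measurable_iff_comap_le.mpr le_rfl) ?_ le_rfl
  refine le_trans ?_ (le_sup_left.trans le_sup_left)
  exact le_iSup₂_of_le l hl (le_iSup₂_of_le k hk le_rfl)

lemma measurable_past_state_history (hl : l ∈ Set.Ico 1 n) (hk : k ∈ Set.Icc 1 (H + 1)) :
    Measurable[history H x π n h] (x l k) := by
  refine Measurable.mono (measurable_iff_comap_le.mpr le_rfl) ?_ le_rfl
  refine le_trans ?_ (le_sup_right.trans le_sup_left)
  exact le_iSup₂_of_le l hl (le_iSup₂_of_le k hk le_rfl)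

lemma measurable_state_history (hk : k ∈ Set.Icc 1 h) :
    Measurable[history H x π n h] (x n k) := by
  refine Measurable.mono (measurable_iff_comap_le.mpr le_rfl) ?_ le_rfl
  refine le_trans ?_ le_sup_right
  exact le_iSup₂_of_le k hk le_rfl

lemma history_le_of_measurable {F : MeasurableSpace Ω}
    (hπ : ∀ l ∈ Set.Icc 1 n, ∀ k ∈ Set.Icc 1 H, Measurable[F] fun ω => π l ω k)
    (hx : ∀ l ∈ Set.Ico 1 n, ∀ k ∈ Set.Icc 1 (H + 1), Measurable[F] (x l k))
    (hx' : ∀ k ∈ Set.Icc 1 h, Measurable[F] (x n k)) : history H x π n h ≤ F := by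
  refine sup_le (sup_le ?_ ?_) ?_
  · exact iSup₂_le fun l hl => iSup₂_le fun k hk => measurable_iff_comap_le.mp (hπ l hl k hk)
  · exact iSup₂_le fun l hl => iSup₂_le fun k hk => measurable_iff_comap_le.mp (hx l hl k hk)
  · exact iSup₂_le fun k hk => measurable_iff_comap_le.mp (hx' k hk)

lemma history_le_succ_stage : history H x π n h ≤ history H x π n (h + 1) :=
  history_le_of_measurable (fun _ hl _ hk => measurable_policy_history hl hk)
    (fun _ hl _ hk => measurable_past_state_history hl hk)
    fun _ hk => measurable_state_history ⟨hk.1, hk.2.trans (Nat.le_succ _)⟩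

lemma history_le_succ_episode (hn : 1 ≤ n) (hh : h ≤ H + 1) :
    history H x π n h ≤ history H x π (n + 1) 1 :=
  history_le_of_measurable
    (fun _ hl _ hk => measurable_policy_history ⟨hl.1, hl.2.trans (Nat.le_succ _)⟩ hk)
    (fun _ hl _ hk => measurable_past_state_history ⟨hl.1, hl.2.trans (Nat.lt_succ_self _)⟩ hk)
    fun _ hk => measurable_past_state_history ⟨hn, Nat.lt_succ_self _⟩ ⟨hk.1, hk.2.trans hh⟩

end History

variable [Fintype St] {m : MatrixMDP St Act d d'}
  {x : ℕ → ℕ → Ω → St} {π : ℕ → Ω → ℕ → St → Act} {lam g : ℝ}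

section Measurability

variable {F : MeasurableSpace Ω}

lemma measurable_phi_policy (hφ : ∀ s, Measurable (m.φ s)) {n h : ℕ}
    (hπ : Measurable[F] fun ω => π n ω h) (s : St) (i : Fin d) :
    Measurable[F] fun ω => m.φ s (π n ω h s) i :=
  (measurable_pi_apply i).comp ((hφ s).comp ((measurable_pi_apply s).comp hπ))

lemma measurable_P_policy (hφ : ∀ s, Measurable (m.φ s)) {n h : ℕ}
    (hπ : Measurable[F] fun ω => π n ω h) (s s' : St) :
    Measurable[F] fun ω => m.P s (π n ω h s) s' := by
  simp only [m.P_eq, dotProduct]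
  exact Finset.measurable_fun_sum _ fun i _ => (measurable_phi_policy hφ hπ s i).mul_const _

lemma measurable_bonusValue (hφ : ∀ s, Measurable (m.φ s)) {n : ℕ}
    {Sg : Ω → Matrix (Fin d) (Fin d) ℝ} (hSg : ∀ i j, Measurable[F] fun ω => Sg ω i j)
    (hπ : ∀ k ∈ Set.Icc 1 m.H, Measurable[F] fun ω => π n ω k) {k : ℕ} (hk : k ≤ m.H) (s : St) :
    Measurable[F] fun ω => m.bonusValue (Sg ω) g (π n ω) k s := by
  induction k generalizing s with
  | zero => exact measurable_const
  | succ k ih =>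
    have hπk := hπ (m.H - k) ⟨by omega, by omega⟩
    refine Measurable.min measurable_const (Measurable.add (Measurable.const_mul ?_ _) ?_)
    · exact (measurable_quadratic (measurable_matrix_inv hSg)
        fun i => measurable_phi_policy hφ hπk s i).sqrt
    · exact Finset.measurable_fun_sum _ fun s' _ =>
        (measurable_P_policy hφ hπk s s').mul (ih (by omega) s')

variable [MeasurableSpace St] [MeasurableSingletonClass St]

lemma measurable_phi_action (hφ : ∀ s, Measurable (m.φ s)) {n h : ℕ}
    (hπ : Measurable[F] fun ω => π n ω h) (hx : Measurable[F] (x n h)) (i : Fin d) :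
    Measurable[F] fun ω => m.φ (x n h ω) (action x π ω n h) i :=
  measurable_apply_of_finite (f := fun ω s => m.φ s (π n ω h s) i)
    (fun s => measurable_phi_policy hφ hπ s i) hx

lemma measurable_Sig (hφ : ∀ s, Measurable (m.φ s)) {n : ℕ}
    (hπ : ∀ l ∈ Set.Ico 1 n, ∀ k ∈ Set.Icc 1 m.H, Measurable[F] fun ω => π l ω k)
    (hx : ∀ l ∈ Set.Ico 1 n, ∀ k ∈ Set.Icc 1 m.H, Measurable[F] (x l k)) (i j : Fin d) :
    Measurable[F] fun ω => m.Sig lam (fun l k => x l k ω) (action x π ω) n i j := by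
  simp only [Sig, Matrix.add_apply, Matrix.sum_apply, vecMulVec_apply]
  refine Measurable.const_add (Finset.measurable_fun_sum _ fun l hl =>
    Finset.measurable_fun_sum _ fun k hk => ?_) _
  have hl' := Finset.mem_Ico.mp hl
  have hk' := Finset.mem_Icc.mp hk
  have h := fun i => measurable_phi_action (m := m) hφ (hπ l hl' k hk') (hx l hl' k hk') i
  exact (h i).mul (h j)

lemma measurable_bonusNoise (hφ : ∀ s, Measurable (m.φ s)) {n h : ℕ}
    {Sg : Ω → Matrix (Fin d) (Fin d) ℝ} (hSg : ∀ i j, Measurable[F] fun ω => Sg ω i j)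
    (hπ : ∀ k ∈ Set.Icc 1 m.H, Measurable[F] fun ω => π n ω k) (hh : h ∈ Set.Icc 1 m.H)
    (hx : Measurable[F] (x n h)) (s' : St) :
    Measurable[F] fun ω => m.bonusNoise (Sg ω) g (π n ω) h (x n h ω) s' := by
  have hb := fun s => measurable_bonusValue (g := g) hφ hSg hπ (Nat.sub_le m.H h) s
  refine measurable_apply_of_finite
    (f := fun ω s => m.bonusNoise (Sg ω) g (π n ω) h s s') (fun s => ?_) hx
  exact (Finset.measurable_fun_sum _ fun s'' _ =>
    (measurable_P_policy hφ (hπ h hh) s s'').mul (hb s'')).sub (hb s')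

end Measurability

variable [MeasurableSpace St] [MeasurableSpace Ω] {μ : Measure Ω} {N : ℕ}
  {U : (ℕ → ℕ → St) → (ℕ → ℕ → Act) → ℕ → Set (Matrix (Fin d) (Fin d') ℝ)}

lemma episode_mem {H t : ℕ} (ht : t < N * H) :
    t / H + 1 ∈ Set.Icc 1 N ∧ t % H + 1 ∈ Set.Icc 1 H := by
  have hH : 0 < H := Nat.pos_of_ne_zero fun h => by simp [h] at ht
  have h1 : t / H < N := (Nat.div_lt_iff_lt_mul hH).mpr ht
  have h2 := Nat.mod_lt t hH
  exact ⟨⟨Nat.le_add_left 1 _, h1⟩, ⟨Nat.le_add_left 1 _, h2⟩⟩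

/-- The times `t = (n - 1) H + (h - 1)` enumerate the stages of all the episodes; at time `t` the
next state is drawn given the history. -/
lemma IsMatrixRLRun.isTransitionProcess (hrun : m.IsMatrixRLRun μ U N x π) :
    IsTransitionProcess μ (fun t => history m.H x π (t / m.H + 1) (t % m.H + 1)) (N * m.H)
      (fun t => x (t / m.H + 1) (t % m.H + 1 + 1))
      (fun t ω s => m.P (x (t / m.H + 1) (t % m.H + 1) ω)
        (action x π ω (t / m.H + 1) (t % m.H + 1)) s) := by
  have hstep : ∀ t, t + 1 < N * m.H →
      ((t + 1) / m.H = t / m.H ∧ (t + 1) % m.H = t % m.H + 1) ∨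
      ((t + 1) / m.H = t / m.H + 1 ∧ (t + 1) % m.H = 0 ∧ t % m.H + 1 = m.H) := by
    intro t ht
    have hH : 0 < m.H := Nat.pos_of_ne_zero fun h => by simp [h] at ht
    have h2 := Nat.mod_lt t hH
    have h3 := Nat.div_add_mod t m.H
    rcases Nat.lt_or_ge (t % m.H + 1) m.H with h | h
    · have h4 : t + 1 = m.H * (t / m.H) + (t % m.H + 1) := by omega
      left
      exact ⟨by rw [h4, Nat.mul_add_div hH, Nat.div_eq_of_lt h, add_zero],
        by rw [h4, Nat.mul_add_mod, Nat.mod_eq_of_lt h]⟩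
    · have h4 : t + 1 = m.H * (t / m.H + 1) := by rw [Nat.mul_add]; omega
      right
      rw [h4, Nat.mul_div_cancel_left _ hH, Nat.mul_mod_right]
      exact ⟨rfl, rfl, by omega⟩
  refine ⟨fun t ht => ?_, fun t ht => ?_, fun t ht => ?_, fun t ht => ?_, fun t _ ω s => ?_,
    fun t _ ω => ?_, fun t ht s => ?_⟩
  · obtain ⟨⟨h1, h2⟩, ⟨h3, h4⟩⟩ := episode_mem ht
    refine history_le_of_measurable
      (fun l hl k hk => hrun.measurable_policy l ⟨hl.1, hl.2.trans h2⟩ k hk)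
      (fun l hl k hk => hrun.measurable_state l ⟨hl.1, hl.2.le.trans h2⟩ k hk)
      (fun k hk => hrun.measurable_state _ ⟨h1, h2⟩ k ⟨hk.1, ?_⟩)
    have := hk.2
    omega
  · rcases hstep t ht with ⟨h1, h2⟩ | ⟨h1, h2, h3⟩
    · rw [h1, h2]
      exact history_le_succ_stage
    · rw [h1, h2, h3]
      exact history_le_succ_episode (Nat.le_add_left 1 _) (Nat.le_succ _)
  · obtain ⟨h1, h2⟩ := episode_mem ht
    exact hrun.measurable_state _ h1 _ ⟨Nat.le_add_left 1 _, Nat.succ_le_succ h2.2⟩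
  · rcases hstep t ht with ⟨h1, h2⟩ | ⟨h1, h2, h3⟩
    · rw [h1, h2]
      exact measurable_state_history ⟨Nat.le_add_left 1 _, le_rfl⟩
    · rw [h1, h2, h3]
      exact measurable_past_state_history ⟨Nat.le_add_left 1 _, Nat.lt_succ_self _⟩
        ⟨Nat.le_add_left 1 _, le_rfl⟩
  · exact m.P_nonneg _ _ _
  · exact m.P_sum _ _
  · obtain ⟨h1, h2⟩ := episode_mem ht
    exact hrun.transition _ h1 _ h2 s

/-- With one-dimensional features the regret is almost surely at most zero. -/
lemma IsMatrixRLRun.regret_le_of_one_dim [IsProbabilityMeasure μ] {m : MatrixMDP St Act 1 d'}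
    {U : (ℕ → ℕ → St) → (ℕ → ℕ → Act) → ℕ → Set (Matrix (Fin 1) (Fin d') ℝ)}
    (hrun : m.IsMatrixRLRun μ U N x π) {Lφ δ γ : ℝ} (hL : 0 ≤ Lφ) (hlam : 0 < lam)
    (hδ0 : 0 < δ) :
    ENNReal.ofReal (1 - 2 * δ) ≤ μ {ω | m.regret N x π ω ≤ m.regretBound Lφ lam δ γ N} := by
  have hae : ∀ᵐ ω ∂μ, m.regret N x π ω ≤ m.regretBound Lφ lam δ γ N := by
    have hgreedy : ∀ᵐ ω ∂μ, ∀ n ∈ Set.Icc 1 N,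
        m.IsGreedy (U (fun l k => x l k ω) (action x π ω) n) (π n ω) := by
      refine (ae_ball_iff (Set.to_countable _)).mpr fun n hn => ?_
      filter_upwards [hrun.greedy n hn] with ω h using h
    filter_upwards [hgreedy] with ω h
    refine le_trans (Finset.sum_nonpos fun n hn => ?_) (m.regretBound_nonneg hL hlam)
    exact sub_nonpos.mpr (m.optValue_le_value_of_phi_const
      (fun s s₂ a a₂ => m.phi_eq_of_one_dim s s₂ a a₂) (h n (Finset.mem_Icc.mp hn)) _)
  refine (ENNReal.ofReal_le_one.mpr (by linarith)).trans
    ((measure_univ (μ := μ)).symm.le.trans (measure_mono_ae ?_))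
  filter_upwards [hae] with ω h _ using h

variable [MeasurableSingletonClass St]

/-- With probability at least `1 - δ`, the self-normalized noise is small for all the columns and
all the episodes. -/
lemma IsMatrixRLRun.measure_noise_le [IsProbabilityMeasure μ] (hrun : m.IsMatrixRLRun μ U N x π)
    (hφ : ∀ s, Measurable (m.φ s)) (hK : IsUnit m.K.det) {Lφ Lψ SM δ : ℝ}
    (hb : m.Bounded Lφ Lψ SM) (hlam : 0 < lam) (hδ0 : 0 < δ) (hR : 0 < m.noise Lφ Lψ SM)
    (hd' : 0 < d') (hH : 0 < m.H) :
    μ {ω | ∃ i : Fin d', ∃ n ∈ Set.Icc 1 N, 1 / (δ / d') ≤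
      √(lam ^ d / (m.Sig lam (fun l k => x l k ω) (action x π ω) n).det) *
        Real.exp (m.noiseSum (fun l k => x l k ω) (action x π ω) i n ⬝ᵥ
          ((m.Sig lam (fun l k => x l k ω) (action x π ω) n)⁻¹ *ᵥ
            m.noiseSum (fun l k => x l k ω) (action x π ω) i n) / (2 * m.noise Lφ Lψ SM ^ 2))}
      ≤ ENNReal.ofReal δ := by
  have hP := hrun.isTransitionProcess
  have hd'0 : (0 : ℝ) < d' := by exact_mod_cast hd'
  set u : ℕ → Ω → Fin d → ℝ := fun t ω =>
    m.φ (x (t / m.H + 1) (t % m.H + 1) ω) (action x π ω (t / m.H + 1) (t % m.H + 1)) with hu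
  set e : Fin d' → ℕ → Ω → St → ℝ := fun i t ω s' =>
    m.noiseAt i (x (t / m.H + 1) (t % m.H + 1) ω)
      (action x π ω (t / m.H + 1) (t % m.H + 1)) s' with he
  have hum : ∀ t < N * m.H, ∀ j, Measurable[history m.H x π (t / m.H + 1) (t % m.H + 1)]
      fun ω => u t ω j := fun t ht j =>
    measurable_phi_action hφ
      (measurable_policy_history ⟨Nat.le_add_left 1 _, le_rfl⟩ (episode_mem ht).2)
      (measurable_state_history ⟨Nat.le_add_left 1 _, le_rfl⟩) j
  have hbad := fun i => hP.measure_exists_selfNormalized_le (u := u) (e := e i)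
    (R := m.noise Lφ Lψ SM) (lam := lam) (δ := δ / d') hR hlam (by positivity) hum
    (fun t ht s' => by
      simp only [he, noiseAt, dotProduct]
      exact measurable_const.sub (Finset.measurable_fun_sum _ fun j _ =>
        (hum t ht j).mul_const _))
    (fun t _ ω s' => m.abs_noiseAt_le hb i _ _ s')
    (fun t _ ω => m.sum_P_mul_noiseAt hK i _ _) (fun _ _ => rfl) (fun _ _ => rfl)
  refine (measure_mono (t := ⋃ i, _) ?_).trans ((measure_iUnion_le _).trans
    ((ENNReal.tsum_le_tsum hbad).trans ?_))
  · rintro ω ⟨i, n, hn, h⟩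
    refine Set.mem_iUnion.mpr ⟨i, (n - 1) * m.H, ?_, ?_⟩
    · exact Nat.mul_lt_mul_of_pos_right (by have := hn.1; have := hn.2; omega) hH
    · obtain ⟨n, rfl⟩ : ∃ k, n = k + 1 := ⟨n - 1, by have := hn.1; omega⟩
      have h1 := sum_range_mul_eq_sum_Icc n m.H fun n h =>
        vecMulVec (m.φ (x n h ω) (action x π ω n h)) (m.φ (x n h ω) (action x π ω n h))
      have h2 := sum_range_mul_eq_sum_Icc n m.H fun n h =>
        m.noiseAt i (x n h ω) (action x π ω n h) (x n (h + 1) ω) •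
          m.φ (x n h ω) (action x π ω n h)
      simp only [Nat.add_sub_cancel, hu, he]
      rw [h1, h2]
      exact h
  · rw [tsum_fintype, Finset.sum_const, Finset.card_univ, Fintype.card_fin, nsmul_eq_mul,
      ← ENNReal.ofReal_natCast, ← ENNReal.ofReal_mul (Nat.cast_nonneg _)]
    exact ENNReal.ofReal_le_ofReal (by rw [mul_div_cancel₀ _ hd'0.ne'])

/-- With probability at least `1 - δ`, the martingale part of the regret is small. -/
lemma IsMatrixRLRun.measure_bonusNoise_le [IsProbabilityMeasure μ]
    (hrun : m.IsMatrixRLRun μ U N x π) (hφ : ∀ s, Measurable (m.φ s)) {δ : ℝ} (hδ0 : 0 < δ)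
    (hδ1 : δ < 1) (hg : 0 ≤ g) (hT : 0 < N * m.H) :
    μ {ω | m.H * √(2 * (N * m.H : ℕ) * Real.log (1 / δ)) <
      ∑ n ∈ Finset.Icc 1 N, ∑ h ∈ Finset.Icc 1 m.H,
        m.bonusNoise (m.Sig lam (fun l k => x l k ω) (action x π ω) n) g (π n ω) h
          (x n h ω) (x n (h + 1) ω)} ≤ ENNReal.ofReal δ := by
  have hP := hrun.isTransitionProcess
  have hH : (0 : ℝ) < m.H := by exact_mod_cast Nat.pos_of_ne_zero fun h => by simp [h] at hT
  have h := hP.measure_sum_gt_le (R := m.H) (δ := δ)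
    (e := fun t ω s' => m.bonusNoise
      (m.Sig lam (fun l k => x l k ω) (action x π ω) (t / m.H + 1)) g (π (t / m.H + 1) ω)
        (t % m.H + 1) (x (t / m.H + 1) (t % m.H + 1) ω) s') hH hT hδ0 hδ1
    (fun t ht s' => by
      refine measurable_bonusNoise hφ (measurable_Sig hφ (fun l hl k hk => ?_)
        fun l hl k hk => ?_) (fun k hk => ?_) (episode_mem ht).2 ?_ s'
      · exact measurable_policy_history ⟨hl.1, hl.2.le⟩ hk
      · exact measurable_past_state_history hl ⟨hk.1, hk.2.trans (Nat.le_succ _)⟩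
      · exact measurable_policy_history ⟨Nat.le_add_left 1 _, le_rfl⟩ hk
      · exact measurable_state_history ⟨Nat.le_add_left 1 _, le_rfl⟩)
    (fun t _ ω s' => m.abs_bonusNoise_le _ hg _ _ _ _)
    (fun t _ ω => m.sum_P_mul_bonusNoise _ _ _ _ _)
  refine le_of_eq_of_le ?_ h
  congr 1
  ext ω
  have := sum_range_mul_eq_sum_Icc N m.H fun n h =>
    m.bonusNoise (m.Sig lam (fun l k => x l k ω) (action x π ω) n) g (π n ω) h
      (x n h ω) (x n (h + 1) ω)
  simp only [Set.mem_ofPred_eq, ← this]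

/-- The regret bound for an algorithm whose confidence sets contain `M⋆` and have width `g`,
whenever each column of `M⋆` is within `√β_n` of its estimate. -/
theorem IsMatrixRLRun.regret_le_of_hasWidth [IsProbabilityMeasure μ]
    (hrun : m.IsMatrixRLRun μ U N x π) (hφ : ∀ s, Measurable (m.φ s)) (hK : IsUnit m.K.det)
    {Lφ Lψ SM δ : ℝ} (hb : m.Bounded Lφ Lψ SM) (hlam : 0 < lam) (hδ0 : 0 < δ) (hδ1 : δ < 1)
    (hN : 2 ≤ N * m.H) (hd : 2 ≤ d) (hd' : 0 < d') (hL : 0 ≤ Lφ) (hR : 0 < m.noise Lφ Lψ SM)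
    (hg0 : 0 ≤ g)
    (hg : 2 * m.H * √(d * Real.log (1 + N * m.H * Lφ ^ 2 / (lam * d))) ≤ g)
    (hU : ∀ x a, ∀ n ∈ Set.Icc 1 N, (∀ i, weightedNorm (m.Sig lam x a n)
        (fun j => (m.Mstar - m.Mhat lam x a n) j i) ≤ m.rootBeta Lφ Lψ SM lam δ n) →
      m.Mstar ∈ U x a n ∧ m.HasWidth (U x a n) (m.Sig lam x a n) g) :
    ENNReal.ofReal (1 - 2 * δ)
      ≤ μ {ω | m.regret N x π ω ≤ m.regretBound Lφ lam δ (g ^ 2) N} := by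
  have hH : 0 < m.H := Nat.pos_of_ne_zero fun h => by simp [h] at hN
  have hbad1 := hrun.measure_noise_le hφ hK hb hlam hδ0 hR hd' hH
  have hbad2 := hrun.measure_bonusNoise_le (lam := lam) hφ hδ0 hδ1 hg0 (by omega)
  have hgreedy : μ {ω | ¬ ∀ n ∈ Set.Icc 1 N,
      m.IsGreedy (U (fun l k => x l k ω) (action x π ω) n) (π n ω)} = 0 := by
    refine ae_iff.mp ?_
    refine (ae_ball_iff (Set.to_countable _)).mpr fun n hn => ?_
    filter_upwards [hrun.greedy n hn] with ω h using h
  set B1 := {ω | ∃ i : Fin d', ∃ n ∈ Set.Icc 1 N, 1 / (δ / d') ≤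
      √(lam ^ d / (m.Sig lam (fun l k => x l k ω) (action x π ω) n).det) *
        Real.exp (m.noiseSum (fun l k => x l k ω) (action x π ω) i n ⬝ᵥ
          ((m.Sig lam (fun l k => x l k ω) (action x π ω) n)⁻¹ *ᵥ
            m.noiseSum (fun l k => x l k ω) (action x π ω) i n) / (2 * m.noise Lφ Lψ SM ^ 2))}
    with hB1
  set B2 := {ω | m.H * √(2 * (N * m.H : ℕ) * Real.log (1 / δ)) <
      ∑ n ∈ Finset.Icc 1 N, ∑ h ∈ Finset.Icc 1 m.H,
        m.bonusNoise (m.Sig lam (fun l k => x l k ω) (action x π ω) n) g (π n ω) h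
          (x n h ω) (x n (h + 1) ω)} with hB2
  set B3 := {ω | ¬ ∀ n ∈ Set.Icc 1 N,
      m.IsGreedy (U (fun l k => x l k ω) (action x π ω) n) (π n ω)} with hB3
  set G := {ω | m.regret N x π ω ≤ m.regretBound Lφ lam δ (g ^ 2) N} with hG
  have hcover : (Set.univ : Set Ω) ⊆ G ∪ B1 ∪ B2 ∪ B3 := by
    intro ω _
    by_contra hω
    simp only [Set.mem_union, not_or] at hω
    obtain ⟨⟨⟨hωG, hω1⟩, hω2⟩, hω3⟩ := hω
    apply hωG
    simp only [hB3, Set.mem_ofPred_eq, not_not] at hω3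
    simp only [hB2, Set.mem_ofPred_eq, not_lt] at hω2
    simp only [hB1, Set.mem_ofPred_eq, not_exists, not_and, not_le] at hω1
    have hUω := fun n hn => hU (fun l k => x l k ω) (action x π ω) n hn fun i =>
      m.weightedNorm_Mstar_sub_Mhat_le_rootBeta _ _ hb hlam hδ0 hδ1 hd hR i n (hω1 i n hn)
    have hreg : m.regret N x π ω ≤ ∑ n ∈ Finset.Icc 1 N, ∑ h ∈ Finset.Icc 1 m.H,
        (min (m.H : ℝ) (g * weightedNorm
          (m.Sig lam (fun l k => x l k ω) (action x π ω) n)⁻¹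
            (m.φ (x n h ω) (action x π ω n h)))
          + m.bonusNoise (m.Sig lam (fun l k => x l k ω) (action x π ω) n) g (π n ω) h
            (x n h ω) (x n (h + 1) ω)) := by
      refine Finset.sum_le_sum fun n hn => ?_
      have hn' : n ∈ Set.Icc 1 N := Finset.mem_Icc.mp hn
      exact (optValue_sub_value_le_bonusValue (hUω n hn').1 (hUω n hn').2 hg0 (hω3 n hn') _).trans
        (m.bonusValue_le_sum _ hg0 (π n ω) fun h => x n h ω)
    have htriv : m.regret N x π ω ≤ N * m.H := by
      refine (Finset.sum_le_card_nsmul _ _ (m.H : ℝ) fun n _ =>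
        m.optValue_sub_value_le_H _ _).trans_eq ?_
      simp
    refine m.le_regretBound hN hL hlam hδ0 hδ1 hg0 hg htriv (hreg.trans ?_)
    simp only [Finset.sum_add_distrib]
    rw [add_comm]
    refine add_le_add hω2 ((sum_min_mul_le hg0 _).trans ?_)
    have hpot := m.sum_min_one_weightedNorm_sq_le (fun l k => x l k ω) (action x π ω)
      hb.phi_le hlam (by omega) N
    gcongr
  have h1 : (1 : ENNReal) ≤ μ G + ENNReal.ofReal (2 * δ) := by
    calc (1 : ENNReal) = μ Set.univ := measure_univ.symm
      _ ≤ μ (G ∪ B1 ∪ B2 ∪ B3) := measure_mono hcover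
      _ ≤ μ G + μ B1 + μ B2 + μ B3 := (measure_union_le _ _).trans (add_le_add
          ((measure_union_le _ _).trans (add_le_add (measure_union_le _ _) le_rfl)) le_rfl)
      _ ≤ μ G + ENNReal.ofReal δ + ENNReal.ofReal δ + 0 := by
          gcongr
          exact hgreedy.le
      _ = μ G + ENNReal.ofReal (2 * δ) := by
          rw [add_zero, add_assoc, ← ENNReal.ofReal_add hδ0.le hδ0.le, two_mul]
  rw [ENNReal.ofReal_sub _ (by positivity), ENNReal.ofReal_one]
  exact tsub_le_iff_right.mpr h1

end MatrixMDP

/-! ### The two confidence sets -/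

namespace MatrixMDP

variable {St Act : Type*} [Fintype St] {d d' : ℕ} (m : MatrixMDP St Act d d')

lemma Mstar_mem_confSet12 {Lφ Lψ SM lam δ : ℝ} (x : ℕ → ℕ → St) (a : ℕ → ℕ → Act) (n : ℕ)
    (h : ∀ i, weightedNorm (m.Sig lam x a n) (fun j => (m.Mstar - m.Mhat lam x a n) j i)
      ≤ m.rootBeta Lφ Lψ SM lam δ n) : m.Mstar ∈ m.confSet12 Lφ Lψ SM lam δ x a n :=
  (Finset.sum_le_card_nsmul _ _ _ fun i _ => h i).trans_eq (by simp)

lemma Mstar_mem_confSetF {Lφ Lψ SM lam δ : ℝ} (x : ℕ → ℕ → St) (a : ℕ → ℕ → Act) (n : ℕ)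
    (h : ∀ i, weightedNorm (m.Sig lam x a n) (fun j => (m.Mstar - m.Mhat lam x a n) j i)
      ≤ m.rootBeta Lφ Lψ SM lam δ n) : m.Mstar ∈ m.confSetF Lφ Lψ SM lam δ x a n :=
  Real.sqrt_le_sqrt ((Finset.sum_le_card_nsmul _ _ _ fun i _ =>
    pow_le_pow_left₀ (weightedNorm_nonneg _ _) (h i) 2).trans_eq (by simp))

variable {m}

/-- A set that contains `M⋆` has width `g` as soon as it has radius `g / 2` around the
estimate. -/
lemma hasWidth_of_radius {U : Set (Matrix (Fin d) (Fin d') ℝ)} {Sg : Matrix (Fin d) (Fin d) ℝ}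
    {M₀ : Matrix (Fin d) (Fin d') ℝ} {g : ℝ} (hU : m.Mstar ∈ U)
    (h : ∀ M ∈ U, ∀ s a, ∀ V : St → ℝ, (∀ s, |V s| ≤ m.H) →
      |m.φ s a ⬝ᵥ ((M - M₀) *ᵥ (m.Psiᵀ *ᵥ V))| ≤ weightedNorm Sg⁻¹ (m.φ s a) * (g / 2)) :
    m.HasWidth U Sg g := by
  intro M hM s a V hV
  have h1 := h M hM s a V hV
  have h2 := h m.Mstar hU s a V hV
  have h3 : M - m.Mstar = (M - M₀) - (m.Mstar - M₀) := by abel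
  rw [h3, sub_mulVec, dotProduct_sub]
  refine (abs_sub _ _).trans ?_
  linarith

lemma norm_le_H {V : St → ℝ} (hV : ∀ s, |V s| ≤ m.H) : ‖V‖ ≤ m.H :=
  (pi_norm_le_iff_of_nonneg (Nat.cast_nonneg _)).mpr hV

lemma hasWidth_confSet12 {Lφ Lψ SM Cψ lam δ g : ℝ} (hlam : 0 < lam) (hC0 : 0 ≤ Cψ)
    (hC : ∀ v : St → ℝ, ‖m.Psiᵀ *ᵥ v‖ ≤ Cψ * ‖v‖) (x : ℕ → ℕ → St) (a : ℕ → ℕ → Act) (n : ℕ)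
    (hU : m.Mstar ∈ m.confSet12 Lφ Lψ SM lam δ x a n)
    (hg : 2 * Cψ * m.H * d' * m.rootBeta Lφ Lψ SM lam δ n ≤ g) :
    m.HasWidth (m.confSet12 Lφ Lψ SM lam δ x a n) (m.Sig lam x a n) g := by
  refine hasWidth_of_radius (M₀ := m.Mhat lam x a n) hU fun M hM s b V hV =>
    (m.abs_dotProduct_mulVec_le x a hlam n _ _ _).trans
      (mul_le_mul_of_nonneg_left ?_ (weightedNorm_nonneg _ _))
  have hw : ‖m.Psiᵀ *ᵥ V‖ ≤ Cψ * m.H :=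
    (hC V).trans (mul_le_mul_of_nonneg_left (norm_le_H hV) hC0)
  calc _ ≤ ∑ i, ‖m.Psiᵀ *ᵥ V‖ *
        weightedNorm (m.Sig lam x a n) (fun j => (M - m.Mhat lam x a n) j i) :=
        Finset.sum_le_sum fun i _ =>
          mul_le_mul_of_nonneg_right (norm_le_pi_norm _ i) (weightedNorm_nonneg _ _)
    _ ≤ (Cψ * m.H) * (d' * m.rootBeta Lφ Lψ SM lam δ n) := by
        rw [← Finset.mul_sum]
        exact mul_le_mul hw hM (Finset.sum_nonneg fun i _ => weightedNorm_nonneg _ _)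
          (by positivity)
    _ ≤ g / 2 := by linarith

lemma hasWidth_confSetF {Lφ Lψ SM Cψ lam δ g : ℝ} (hlam : 0 < lam) (hC0 : 0 ≤ Cψ)
    (hC : ∀ v : St → ℝ, l2norm (m.Psiᵀ *ᵥ v) ≤ Cψ * ‖v‖) (x : ℕ → ℕ → St) (a : ℕ → ℕ → Act)
    (n : ℕ) (hβ : 0 ≤ m.rootBeta Lφ Lψ SM lam δ n)
    (hU : m.Mstar ∈ m.confSetF Lφ Lψ SM lam δ x a n)
    (hg : 2 * Cψ * m.H * √d' * m.rootBeta Lφ Lψ SM lam δ n ≤ g) :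
    m.HasWidth (m.confSetF Lφ Lψ SM lam δ x a n) (m.Sig lam x a n) g := by
  refine hasWidth_of_radius (M₀ := m.Mhat lam x a n) hU fun M hM s b V hV =>
    (m.abs_dotProduct_mulVec_le x a hlam n _ _ _).trans
      (mul_le_mul_of_nonneg_left ?_ (weightedNorm_nonneg _ _))
  have hw : l2norm (m.Psiᵀ *ᵥ V) ≤ Cψ * m.H :=
    (hC V).trans (mul_le_mul_of_nonneg_left (norm_le_H hV) hC0)
  have hsq : √(∑ i, |(m.Psiᵀ *ᵥ V) i| ^ 2) = l2norm (m.Psiᵀ *ᵥ V) := by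
    rw [l2norm, EuclideanSpace.norm_eq]
    simp
  have hM' : √(∑ i, weightedNorm (m.Sig lam x a n) (fun j => (M - m.Mhat lam x a n) j i) ^ 2)
      ≤ √d' * m.rootBeta Lφ Lψ SM lam δ n := by
    refine le_trans hM (le_of_eq ?_)
    rw [Real.sqrt_mul (Nat.cast_nonneg _), Real.sqrt_sq hβ]
  calc _ ≤ √(∑ i, |(m.Psiᵀ *ᵥ V) i| ^ 2) * √(∑ i, weightedNorm (m.Sig lam x a n)
        (fun j => (M - m.Mhat lam x a n) j i) ^ 2) := Real.sum_mul_le_sqrt_mul_sqrt _ _ _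
    _ ≤ (Cψ * m.H) * (√d' * m.rootBeta Lφ Lψ SM lam δ n) := by
        rw [hsq]
        exact mul_le_mul hw hM' (Real.sqrt_nonneg _) (by positivity)
    _ ≤ g / 2 := by linarith

/-- `√β_N` dominates the square root of the total potential of all the episodes, so that the
bonuses are never small in comparison with the cost of the episodes of large potential. -/
lemma sqrt_potential_le_mul_rootBeta {Lφ Lψ SM lam δ c : ℝ} {N : ℕ} (hlam : 0 < lam)
    (hδ0 : 0 < δ) (hδ1 : δ < 1) (hd : 0 < d) (hd' : 0 < d') (hSM : 0 ≤ SM) (hc : 0 ≤ c)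
    (h : 1 ≤ c * m.noise Lφ Lψ SM) :
    √(d * Real.log (1 + N * m.H * Lφ ^ 2 / (lam * d))) ≤ c * m.rootBeta Lφ Lψ SM lam δ N := by
  have hd1 : (1 : ℝ) ≤ d := by exact_mod_cast hd
  have hd'1 : (1 : ℝ) ≤ d' := by exact_mod_cast hd'
  have hlog : Real.log (1 + N * m.H * Lφ ^ 2 / (lam * d))
      ≤ Real.log ((d' + d' * N * m.H * Lφ ^ 2 / lam) / δ) := by
    refine Real.log_le_log (by positivity) ?_
    have h1 : N * m.H * Lφ ^ 2 / (lam * d) ≤ N * m.H * Lφ ^ 2 / lam := by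
      have h2 : lam ≤ lam * d := le_mul_of_one_le_right hlam.le hd1
      gcongr
    have h3 : 0 ≤ N * m.H * Lφ ^ 2 / lam := by positivity
    have h4 : (d' + d' * N * m.H * Lφ ^ 2 / lam) / δ
        = d' / δ * (1 + N * m.H * Lφ ^ 2 / lam) := by
      field_simp
    have h5 : 1 ≤ d' / δ := by
      rw [le_div_iff₀ hδ0]
      linarith
    rw [h4]
    nlinarith
  set L₁ := √(d * Real.log (1 + N * m.H * Lφ ^ 2 / (lam * d))) with hL₁
  set L₂ := √(d * Real.log ((d' + d' * N * m.H * Lφ ^ 2 / lam) / δ)) with hL₂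
  have hL : L₁ ≤ L₂ := Real.sqrt_le_sqrt (mul_le_mul_of_nonneg_left hlog (by positivity))
  calc L₁ ≤ L₂ := hL
    _ ≤ (c * m.noise Lφ Lψ SM) * L₂ := le_mul_of_one_le_left (Real.sqrt_nonneg _) h
    _ ≤ c * m.rootBeta Lφ Lψ SM lam δ N := by
        rw [mul_assoc]
        exact mul_le_mul_of_nonneg_left (le_add_of_nonneg_right (by positivity)) hc

lemma pos_of_P {m : MatrixMDP St Act d d'} (s : St) (a : Act) : 0 < d ∧ 0 < d' := by
  have h := m.P_sum s a
  constructor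
  · refine Nat.pos_of_ne_zero fun h0 => ?_
    subst h0
    simp [m.P_eq] at h
  · refine Nat.pos_of_ne_zero fun h0 => ?_
    subst h0
    have : ∀ s', m.Mstar *ᵥ m.ψ s' = 0 := fun s' => by
      ext i
      simp [mulVec]
    simp [m.P_eq, this] at h

end MatrixMDP

theorem mainTheorem3 {St Act : Type*} [Fintype St] [MeasurableSpace St]
    [MeasurableSingletonClass St] [MeasurableSpace Act] {d d' : ℕ}
    (m : MatrixMDP St Act d d')
    (hφ_meas : ∀ s, Measurable (m.φ s)) (hr_meas : ∀ s, Measurable (m.r s))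
    (hK : IsUnit m.K.det)
    (Lφ Lψ SM : ℝ) (hbdd : m.Bounded Lφ Lψ SM)
    (Cψ Cψ' lam δ : ℝ) (hlam : 0 < lam) (hδ0 : 0 < δ) (hδ1 : δ < 1)
    (N : ℕ) (hN : 2 ≤ N * m.H)
    {Ω : Type*} [MeasurableSpace Ω] (μ : Measure Ω) [IsProbabilityMeasure μ]
    (x : ℕ → ℕ → Ω → St) (π : ℕ → Ω → ℕ → St → Act) :
    (m.FeatureRegularity Cψ Cψ' →
      m.IsMatrixRLRun μ (m.confSet12 Lφ Lψ SM lam δ) N x π →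
      ENNReal.ofReal (1 - 2 * δ) ≤
        μ {ω | m.regret N x π ω ≤ m.regretBound Lφ lam δ
          ((2 * Cψ * m.H * d' * m.rootBeta Lφ Lψ SM lam δ N) ^ 2) N}) ∧
    (m.StrongFeatureRegularity Cψ Cψ' →
      m.IsMatrixRLRun μ (m.confSetF Lφ Lψ SM lam δ) N x π →
      ENNReal.ofReal (1 - 2 * δ) ≤
        μ {ω | m.regret N x π ω ≤ m.regretBound Lφ lam δ
          ((2 * Cψ * m.H * √d' * m.rootBeta Lφ Lψ SM lam δ N) ^ 2) N}) := by
  obtain ⟨ω₀⟩ : Nonempty Ω := nonempty_of_isProbabilityMeasure μ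
  have s₀ : St := x 1 1 ω₀
  have a₀ : Act := π 1 ω₀ 1 s₀
  obtain ⟨hd, hd'⟩ := MatrixMDP.pos_of_P (m := m) s₀ a₀
  have hL0 : 0 ≤ Lφ := (l2norm_nonneg _).trans (hbdd.phi_le s₀ a₀)
  have hLψ0 : 0 ≤ Lψ := (l2norm_nonneg _).trans (hbdd.psi_le s₀)
  have hSM0 : 0 ≤ SM := (l2norm_nonneg _).trans (hbdd.col_le ⟨0, hd'⟩)
  have hR0 := m.noise_nonneg hL0 hLψ0 hSM0
  have hd'1 : (1 : ℝ) ≤ d' := by exact_mod_cast hd'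
  rcases (by omega : d = 1 ∨ 2 ≤ d) with rfl | hd2
  · exact ⟨fun _ hrun => hrun.regret_le_of_one_dim hL0 hlam hδ0,
      fun _ hrun => hrun.regret_le_of_one_dim hL0 hlam hδ0⟩
  have hβ0 := m.rootBeta_nonneg (lam := lam) (δ := δ) hR0 hSM0
  have hβ := fun n (hn : n ∈ Set.Icc 1 N) => m.rootBeta_mono hR0 hd' hlam hδ0 hn.2
  have hone : ‖(1 : St → ℝ)‖ = 1 := by
    have : Nonempty St := ⟨s₀⟩
    exact norm_one
  -- a common form of the two cases, with `c H` the ratio of `√γ_N / 2` and `√β_N`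
  have hmain : ∀ {U : (ℕ → ℕ → St) → (ℕ → ℕ → Act) → ℕ → Set (Matrix (Fin d) (Fin d') ℝ)}
      {c C : ℝ}, 0 ≤ C → C ≤ c → (∀ v : St → ℝ, l2norm (m.Psiᵀ *ᵥ v) ≤ C * ‖v‖) →
      m.IsMatrixRLRun μ U N x π →
      (∀ x a, ∀ n ∈ Set.Icc 1 N, (∀ i, MatrixMDP.weightedNorm (m.Sig lam x a n)
        (fun j => (m.Mstar - m.Mhat lam x a n) j i) ≤ m.rootBeta Lφ Lψ SM lam δ n) →
        m.Mstar ∈ U x a n ∧ m.HasWidth (U x a n) (m.Sig lam x a n)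
          (2 * m.H * (c * m.rootBeta Lφ Lψ SM lam δ N))) →
      ENNReal.ofReal (1 - 2 * δ) ≤ μ {ω | m.regret N x π ω ≤ m.regretBound Lφ lam δ
          ((2 * m.H * (c * m.rootBeta Lφ Lψ SM lam δ N)) ^ 2) N} := by
    intro U c C hC0 hCc hC hrun hU
    have hc0 := hC0.trans hCc
    have h1 : 1 ≤ c * m.noise Lφ Lψ SM := by
      refine (m.one_le_norm_K_inv_mul hK hbdd.psi_le hLψ0 hC0 hC ⟨0, hd'⟩).trans ?_
      rw [mul_left_comm]
      exact mul_le_mul hCc (le_add_of_nonneg_right (by positivity)) (by positivity) hc0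
    have hR : 0 < m.noise Lφ Lψ SM := hR0.lt_of_ne fun h => by
      rw [← h] at h1
      linarith
    refine hrun.regret_le_of_hasWidth hφ_meas hK hbdd hlam hδ0 hδ1 hN hd2 hd' hL0 hR
      (by have := hβ0 N; positivity) ?_ hU
    exact mul_le_mul_of_nonneg_left
      (MatrixMDP.sqrt_potential_le_mul_rootBeta hlam hδ0 hδ1 hd hd' hSM0 hc0 h1) (by positivity)
  constructor
  · intro hreg hrun
    have hC0 : 0 ≤ Cψ := by
      have := (norm_nonneg _).trans (hreg.psi_le 1)
      rwa [hone, mul_one] at this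
    have h := hmain (c := Cψ * d') (C := √d' * Cψ) (by positivity)
      (by
        rw [mul_comm]
        exact mul_le_mul_of_nonneg_left ((Real.sqrt_le_left (by linarith)).mpr (by nlinarith)) hC0)
      (fun v => (l2norm_le_sqrt_mul_norm _).trans (by
        rw [mul_assoc]
        exact mul_le_mul_of_nonneg_left (hreg.psi_le v) (Real.sqrt_nonneg _))) hrun
      fun x a n hn hi => by
        have hU := m.Mstar_mem_confSet12 x a n hi
        refine ⟨hU, MatrixMDP.hasWidth_confSet12 hlam hC0 hreg.psi_le x a n hU ?_⟩
        have h2 := mul_le_mul_of_nonneg_left (hβ n hn)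
          (show 0 ≤ 2 * Cψ * m.H * d' by positivity)
        linarith
    have h3 : 2 * m.H * (Cψ * d' * m.rootBeta Lφ Lψ SM lam δ N)
        = 2 * Cψ * m.H * d' * m.rootBeta Lφ Lψ SM lam δ N := by ring
    rwa [h3] at h
  · intro hreg hrun
    have hC0 : 0 ≤ Cψ := by
      have := (l2norm_nonneg _).trans (hreg.psi_le 1)
      rwa [hone, mul_one] at this
    have h := hmain (c := Cψ * √d') (C := Cψ) hC0
      (le_mul_of_one_le_right hC0 (Real.one_le_sqrt.mpr hd'1)) hreg.psi_le hrun
      fun x a n hn hi => by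
        have hU := m.Mstar_mem_confSetF x a n hi
        refine ⟨hU, MatrixMDP.hasWidth_confSetF hlam hC0 hreg.psi_le x a n (hβ0 n) hU ?_⟩
        have h2 := mul_le_mul_of_nonneg_left (hβ n hn)
          (show 0 ≤ 2 * Cψ * m.H * √d' by positivity)
        linarith
    have h3 : 2 * m.H * (Cψ * √d' * m.rootBeta Lφ Lψ SM lam δ N)
        = 2 * Cψ * m.H * √d' * m.rootBeta Lφ Lψ SM lam δ N := by ring
    rwa [h3] at h
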